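/- **Setting.** Let $G=(\mathcal V,\sim)$ be a finite connected graph, $N=|\mathcal V|$, $n=2N$, let $\emptyset\neq\partial\mathcal V\subset\mathcal D\subset\mathcal V$ be the boundary set and the damped set, and let $T_i\ge 0$ ($i\in\partial\mathcal V$) be temperatures. With harmonic pinning and interaction potentials $U(q)=V(q)=q^2/2$ the Hamiltonian is $$H(q,p)=\sum_{i\in\mathcal V}\Big(\tfrac12p_i^2+V(q_i)+\tfrac12\sum_{j\sim i}U(q_i-q_j)\Big),\qquad (q,p)\in\mathbb R^{\mathcal V}\times\mathbb R^{\mathcal V}.$$ The heat conduction network is the diffusion $Z=(q,p)$ that solves $$dq_i=p_i\,dt,\qquad dp_i=-\partial_{q_i}H\,dt-\mathbf 1_{i\in\mathcal D}\,p_i\,dt+\mathbf 1_{i\in\partial\mathcal V}\sqrt{2T_i}\,dB_i\qquad(i\in\mathcal V),$$ where $(B_i)_{i\in\partial\mathcal V}$ are independent standard Brownian motions; that is, $dZ=MZ\,dt+\sigma\,dB$ with $$M=\begin{pmatrix}0&I\\-\Gamma&-I_{\mathcal D}\end{pmatrix},\quad \sigma=\begin{pmatrix}0&0\\0&\mathrm{diag}(\sqrt{2T_i}\,\mathbf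 1_{i\in\partial\mathcal V})\end{pmatrix},\quad\Gamma=I+\Delta,\quad I_{\mathcal D}=\mathrm{diag}(\mathbf 1_{i\in\mathcal D}),$$ where $\Delta$ is the graph Laplacian (degree matrix minus adjacency matrix). Let $Z^z$ be the solution that starts from $z$ and $P_t(z,A)=\mathbb P(Z^z_t\in A)$. A probability measure $\mu$ on $\mathbb R^n$ is *invariant* if $\int P_t(z,A)\,\mu(dz)=\mu(A)$ for all $t\ge0$ and all Borel sets $A$. Let $e_{p_i}$ be the canonical basis vector of the coordinate $p_i$ and $$E_{M,\mathcal D}=\mathrm{Span}\{M^ke_{p_i}:\ i\in\mathcal D,\ k\in\mathbb N\}.$$ The network is *asymmetric* if $\dim E_{M,\mathcal D}=n$. **Theorem.** (1) There exists a unique invariant probability measure if and only if the network is asymmetric. (2) If the network is not asymmetric, then there are $\alpha\in\mathbb R$ and a vector $\zeta\in\mathbb R^{\mathcal V}\setminus\{0\}$ with $\Gamma\zeta=\alpha\zeta$ and both $(\zeta,0)$ and $(0,\zeta)$ orthogonal to $E_{M,\mathcal D}$, such that the quantity $$K(q,p)=\alpha\langle\zeta,q\rangle^2+\langle\zeta,p\rangle^2$$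 is invariant under the Hamiltonian flow of $H$ (constant along every solution of $\dot q=\partial_pH$, $\dot p=-\partial_qH$) and does not depend on $(q_i,p_i)_{i\in\mathcal D}$. Moreover the invariant measure is not unique: there are at least two distinct invariant probability measures. -/

import Mathlib

open MeasureTheory ProbabilityTheory
open scoped NNReal

namespace HeatNetwork

/-- Phase space of a network with vertex set `𝒱`: `z (Sum.inl i)` is the position `q_i` and
`z (Sum.inr i)` the momentum `p_i` of the particle at the vertex `i`. -/
abbrev Phase (𝒱 : Type*) := 𝒱 ⊕ 𝒱 → ℝ

lemma hasDerivAt_update {ι : Type*} [DecidableEq ι] (z : ι → ℝ) (a b : ι) (s : ℝ) :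
    HasDerivAt (fun s => Function.update z a s b) (if b = a then 1 else 0) s := by
  by_cases h : b = a
  · subst h
    simpa using hasDerivAt_id' s
  · simpa [Function.update_of_ne h, h] using hasDerivAt_const s (z b)

section Dynamics

variable {𝒱 : Type*} [Fintype 𝒱] [DecidableEq 𝒱] (G : SimpleGraph 𝒱) [DecidableRel G.Adj]

/-- The Hamiltonian with interaction potential `U` and pinning potential `V`. -/
noncomputable def hamiltonian (U V : ℝ → ℝ) (z : Phase 𝒱) : ℝ :=
  ∑ i, ((z (Sum.inr i)) ^ 2 / 2 + V (z (Sum.inl i))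
    + (1 / 2) * ∑ j ∈ G.neighborFinset i, U (z (Sum.inl i) - z (Sum.inl j)))

/-- The partial derivative of `f` at `z` in the coordinate `a`. -/
noncomputable def partialDeriv (f : Phase 𝒱 → ℝ) (a : 𝒱 ⊕ 𝒱) (z : Phase 𝒱) : ℝ :=
  deriv (fun s => f (Function.update z a s)) (z a)

/-- The Hamiltonian vector field `(∂H/∂p, -∂H/∂q)`. -/
noncomputable def hamiltonianField (U V : ℝ → ℝ) (z : Phase 𝒱) : Phase 𝒱 :=
  Sum.elim (fun i => partialDeriv (hamiltonian G U V) (Sum.inr i) z)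
    (fun i => - partialDeriv (hamiltonian G U V) (Sum.inl i) z)

/-- The drift of the network: the Hamiltonian vector field, and a friction `-p_i` in the momentum
equation of each damped particle. -/
noncomputable def drift (U V : ℝ → ℝ) (D : Finset 𝒱) (z : Phase 𝒱) : Phase 𝒱 :=
  hamiltonianField G U V z - Sum.elim (fun _ => 0) (fun i => if i ∈ D then z (Sum.inr i) else 0)

/-- The noise term: `√(2 T_i) w_i` in the momentum equation of each boundary particle. -/
noncomputable def noise (bd : Finset 𝒱) (T : 𝒱 → ℝ) (w : bd → ℝ) : Phase 𝒱 :=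
  Sum.elim (fun _ => 0) (fun i => if h : i ∈ bd then Real.sqrt (2 * T i) * w ⟨i, h⟩ else 0)

/-- `B` is a family of independent standard Brownian motions. -/
structure IsBrownianFamily {ι Ω : Type*} [MeasurableSpace Ω] (P : Measure Ω)
    (B : ι → ℝ≥0 → Ω → ℝ) : Prop where
  brownian : ∀ i, IsBrownianReal (B i) P
  indep : iIndepFun (fun i ω t => B i t ω) P

/-- `Z` solves, from the starting point `z₀`, the stochastic differential equation
`dq_i = ∂H/∂p_i dt`, `dp_i = -∂H/∂q_i dt - 1_{i ∈ D} p_i dt + 1_{i ∈ bd} √(2 T_i) dB_i`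
driven by `B`. The noise is additive, so the stochastic integral of the constant diffusion
coefficient is just its product with `B`. -/
structure IsSolution {Ω : Type*} [MeasurableSpace Ω] (P : Measure Ω)
    (U V : ℝ → ℝ) (D bd : Finset 𝒱) (T : 𝒱 → ℝ) (B : bd → ℝ≥0 → Ω → ℝ)
    (z₀ : Phase 𝒱) (Z : ℝ≥0 → Ω → Phase 𝒱) : Prop where
  aemeasurable : ∀ t, AEMeasurable (Z t) P
  continuous_paths : ∀ᵐ ω ∂P, Continuous (fun t => Z t ω)
  integral_eq : ∀ᵐ ω ∂P, ∀ (t : ℝ≥0) (a : 𝒱 ⊕ 𝒱),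
    Z t ω a = z₀ a + (∫ s in (0 : ℝ)..t, drift G U V D (Z s.toNNReal ω) a)
      + noise bd T (fun i => B i t ω) a

/-- Invariance of `μ` under the semigroup `P_t(z, A) = ℙ(Z_t^z ∈ A)` of the diffusion, where
`Z z` is the solution that starts from `z`: `∫ P_t(z, A) μ(dz) = μ(A)` for all `t ≥ 0` and all
measurable `A`. -/
def IsInvariant {Ω : Type*} [MeasurableSpace Ω] (P : Measure Ω)
    (Z : Phase 𝒱 → ℝ≥0 → Ω → Phase 𝒱) (μ : Measure (Phase 𝒱)) : Prop :=
  ∀ (t : ℝ≥0) (A : Set (Phase 𝒱)), MeasurableSet A → ∫⁻ z, (P.map (Z z t)) A ∂μ = μ A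

/-- `K` is invariant under the Hamiltonian flow: it is constant along every solution of
Hamilton's equations. -/
def IsHamiltonianInvariant (U V : ℝ → ℝ) (K : Phase 𝒱 → ℝ) : Prop :=
  ∀ x : ℝ → Phase 𝒱, (∀ t, HasDerivAt x (hamiltonianField G U V (x t)) t) →
    ∀ t, K (x t) = K (x 0)

/-- The harmonic potential. -/
noncomputable def harmonic (x : ℝ) : ℝ := x ^ 2 / 2

/-- The matrix `Γ = I + Δ`, where `Δ` is the graph Laplacian (degree matrix minus adjacency
matrix). -/
noncomputable def Gam : Matrix 𝒱 𝒱 ℝ := 1 + G.lapMatrix ℝ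

/-- The matrix `M` of the linear drift of the harmonic network. -/
noncomputable def driftMatrix (D : Finset 𝒱) : Matrix (𝒱 ⊕ 𝒱) (𝒱 ⊕ 𝒱) ℝ :=
  Matrix.fromBlocks 0 1 (- Gam G) (- Matrix.diagonal (fun i => if i ∈ D then 1 else 0))

/-- The controllability space: the span of `M ^ k e_{p_i}`, `i ∈ I`, `k ∈ ℕ`, where `e_{p_i}` is
the basis vector of the momentum of particle `i`. -/
def controlSpace (M : Matrix (𝒱 ⊕ 𝒱) (𝒱 ⊕ 𝒱) ℝ) (I : Finset 𝒱) : Submodule ℝ (Phase 𝒱) :=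
  Submodule.span ℝ {v | ∃ i ∈ I, ∃ k : ℕ, v = (M ^ k).mulVec (Pi.single (Sum.inr i) 1)}

/-- The harmonic network is asymmetric: the controllability space of the damped set has the full
dimension `n = 2 |𝒱|`. -/
def IsAsymmetric (D : Finset 𝒱) : Prop :=
  Module.finrank ℝ (controlSpace (driftMatrix G D) D) = 2 * Fintype.card 𝒱

/-- The quadratic quantity `K(q, p) = α ⟨ζ, q⟩² + ⟨ζ, p⟩²`. -/
def quadraticQuantity (α : ℝ) (ζ : 𝒱 → ℝ) (z : Phase 𝒱) : ℝ :=
  α * (∑ i, ζ i * z (Sum.inl i)) ^ 2 + (∑ i, ζ i * z (Sum.inr i)) ^ 2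

lemma partialDeriv_hamiltonian_harmonic (a : 𝒱 ⊕ 𝒱) (z : Phase 𝒱) :
    partialDeriv (hamiltonian G harmonic harmonic) a z =
      ∑ i, (z (Sum.inr i) * (if Sum.inr i = a then 1 else 0)
        + z (Sum.inl i) * (if Sum.inl i = a then 1 else 0)
        + (1 / 2) * ∑ j ∈ G.neighborFinset i, (z (Sum.inl i) - z (Sum.inl j))
          * ((if Sum.inl i = a then 1 else 0) - (if Sum.inl j = a then 1 else 0))) := by
  have hsq : ∀ (g : ℝ → ℝ) (g' s : ℝ), HasDerivAt g g' s →
      HasDerivAt (fun s => g s ^ 2 / 2) (g s * g') s := by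
    intro g g' s hg
    exact ((hg.fun_pow 2).div_const 2).congr_deriv (by push_cast; ring)
  unfold partialDeriv hamiltonian harmonic
  refine HasDerivAt.deriv ?_
  refine HasDerivAt.fun_sum fun i _ => ?_
  refine HasDerivAt.add (HasDerivAt.add ?_ ?_) (HasDerivAt.const_mul _ ?_)
  · simpa using hsq _ _ _ (hasDerivAt_update z a (Sum.inr i) (z a))
  · simpa using hsq _ _ _ (hasDerivAt_update z a (Sum.inl i) (z a))
  · refine HasDerivAt.fun_sum fun j _ => ?_
    simpa using hsq _ _ _ ((hasDerivAt_update z a (Sum.inl i) (z a)).sub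
      (hasDerivAt_update z a (Sum.inl j) (z a)))

/-- The drift of the harmonic network is linear, with matrix `M`. -/
lemma drift_harmonic (D : Finset 𝒱) (z : Phase 𝒱) :
    drift G harmonic harmonic D z = (driftMatrix G D).mulVec z := by
  ext a
  rw [driftMatrix, Matrix.fromBlocks_mulVec]
  rcases a with i | i
  · simp [drift, hamiltonianField, partialDeriv_hamiltonian_harmonic]
  · have h1 : ∑ k, ∑ j ∈ G.neighborFinset k, (z (Sum.inl k) - z (Sum.inl j))
        * ((if k = i then 1 else 0) - (if j = i then 1 else 0))
        = 2 * ∑ j ∈ G.neighborFinset i, (z (Sum.inl i) - z (Sum.inl j)) := by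
      have e1 : ∀ f : 𝒱 → 𝒱 → ℝ, ∑ k, ∑ j ∈ G.neighborFinset k, (if k = i then f k j else 0)
          = ∑ j ∈ G.neighborFinset i, f i j := by
        intro f
        rw [Finset.sum_eq_single i]
        · simp
        · intro b _ hb
          simp [hb]
        · simp
      have e2 : ∀ f : 𝒱 → 𝒱 → ℝ, ∑ k, ∑ j ∈ G.neighborFinset k, (if j = i then f k j else 0)
          = ∑ j ∈ G.neighborFinset i, f j i := by
        intro f
        have : ∀ k, ∑ j ∈ G.neighborFinset k, (if j = i then f k j else 0)
            = if k ∈ G.neighborFinset i then f k i else 0 := by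
          intro k
          simp [Finset.sum_ite_eq', G.adj_comm]
        simp only [this, Finset.sum_ite_mem, Finset.univ_inter]
      have e3 : ∑ j ∈ G.neighborFinset i, (z (Sum.inl j) - z (Sum.inl i))
          = - ∑ j ∈ G.neighborFinset i, (z (Sum.inl i) - z (Sum.inl j)) := by
        simp only [← Finset.sum_neg_distrib, neg_sub]
      calc _ = ∑ k, ∑ j ∈ G.neighborFinset k, (if k = i then z (Sum.inl k) - z (Sum.inl j) else 0)
            - ∑ k, ∑ j ∈ G.neighborFinset k,
              (if j = i then z (Sum.inl k) - z (Sum.inl j) else 0) := by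
            simp only [← Finset.sum_sub_distrib]
            refine Finset.sum_congr rfl fun k _ => Finset.sum_congr rfl fun j _ => ?_
            split_ifs <;> ring
        _ = _ := by
            rw [e1 (fun k j => z (Sum.inl k) - z (Sum.inl j)),
              e2 (fun k j => z (Sum.inl k) - z (Sum.inl j)), e3]
            ring
    simp [drift, hamiltonianField, partialDeriv_hamiltonian_harmonic, Finset.sum_add_distrib,
      ← Finset.mul_sum, h1, Gam, Matrix.neg_mulVec, Matrix.add_mulVec,
      SimpleGraph.lapMatrix_mulVec_apply, Matrix.mulVec_diagonal]
    ring

end Dynamics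

end HeatNetwork

namespace HeatNetwork

lemma hasDerivAt_dotProduct {ι : Type*} [Fintype ι] {f g : ℝ → ι → ℝ} {f' g' : ι → ℝ} {t : ℝ}
    (hf : HasDerivAt f f' t) (hg : HasDerivAt g g' t) :
    HasDerivAt (fun s => f s ⬝ᵥ g s) (f' ⬝ᵥ g t + f t ⬝ᵥ g') t := by
  simp only [dotProduct, ← Finset.sum_add_distrib]
  exact HasDerivAt.fun_sum fun i _ => (hasDerivAt_pi.1 hf i).mul (hasDerivAt_pi.1 hg i)

section Flow

variable {ι : Type*} [Fintype ι] [DecidableEq ι]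

/-- The flow `exp (t A)` of the linear system `x' = A x`. -/
noncomputable def flow (A : Matrix ι ι ℝ) (t : ℝ) : (ι → ℝ) →L[ℝ] (ι → ℝ) :=
  NormedSpace.exp (t • LinearMap.toContinuousLinearMap (Matrix.toLin' A))

@[simp] lemma flow_zero (A : Matrix ι ι ℝ) (ξ : ι → ℝ) : flow A 0 ξ = ξ := by
  simp [flow]

lemma flow_add (A : Matrix ι ι ℝ) (s t : ℝ) (ξ : ι → ℝ) :
    flow A (s + t) ξ = flow A s (flow A t ξ) := by
  unfold flow
  let _ : NormedAlgebra ℚ ((ι → ℝ) →L[ℝ] (ι → ℝ)) := NormedAlgebra.restrictScalars ℚ ℝ _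
  rw [add_smul, NormedSpace.exp_add_of_commute]
  · rfl
  · exact ((Commute.refl _).smul_left s).smul_right t

lemma hasDerivAt_flow (A : Matrix ι ι ℝ) (ξ : ι → ℝ) (t : ℝ) :
    HasDerivAt (fun s => flow A s ξ) (A.mulVec (flow A t ξ)) t := by
  have h := hasDerivAt_exp_smul_const' (𝕂 := ℝ)
    (LinearMap.toContinuousLinearMap (Matrix.toLin' A)) t
  have h2 := h.clm_apply (hasDerivAt_const t ξ)
  simpa [flow] using h2

@[fun_prop]
lemma continuous_flow (A : Matrix ι ι ℝ) (ξ : ι → ℝ) : Continuous (fun s => flow A s ξ) :=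
  continuous_iff_continuousAt.2 fun t => (hasDerivAt_flow A ξ t).continuousAt

@[fun_prop]
lemma continuous_flow_apply (A : Matrix ι ι ℝ) (ξ : ι → ℝ) (i : ι) :
    Continuous (fun s => flow A s ξ i) :=
  (continuous_apply i).comp (continuous_flow A ξ)

/-- The transpose of the flow `exp (t A)`. -/
noncomputable def adjointFlow (A : Matrix ι ι ℝ) (t : ℝ) : (ι → ℝ) →L[ℝ] (ι → ℝ) :=
  LinearMap.toContinuousLinearMap
    (Matrix.toLin' (LinearMap.toMatrix' (flow A t : (ι → ℝ) →ₗ[ℝ] (ι → ℝ))).transpose)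

lemma dotProduct_adjointFlow (A : Matrix ι ι ℝ) (t : ℝ) (ξ z : ι → ℝ) :
    ξ ⬝ᵥ adjointFlow A t z = flow A t ξ ⬝ᵥ z := by
  simp only [adjointFlow, LinearMap.coe_toContinuousLinearMap', Matrix.toLin'_apply]
  rw [Matrix.dotProduct_mulVec, Matrix.vecMul_transpose, ← Matrix.toLin'_apply,
    Matrix.toLin'_toMatrix']
  rfl

/-- One step of the variation of constants formula, up to a small error. -/
lemma abs_variation_step_le (A : Matrix ι ι ℝ) (ξ : ι → ℝ) {y w : ℝ → ι → ℝ} {z : ι → ℝ}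
    (hy : Continuous y) {a b t ε : ℝ} (ha : 0 ≤ a) (hab : a ≤ b)
    (hyw : ∀ s, 0 ≤ s → ∀ i, y s i = z i + (∫ r in (0 : ℝ)..s, A.transpose.mulVec (y r) i) + w s i)
    (hε : ∀ s ∈ Set.Icc a b,
      |A.mulVec (flow A (t - b) ξ) ⬝ᵥ y s - A.mulVec (flow A (t - s) ξ) ⬝ᵥ y a| ≤ ε) :
    |flow A (t - b) ξ ⬝ᵥ y b - flow A (t - a) ξ ⬝ᵥ y a
      - flow A (t - b) ξ ⬝ᵥ (w b - w a)| ≤ ε * (b - a) := by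
  have hcont : ∀ i, Continuous fun r => A.transpose.mulVec (y r) i := fun i =>
    (continuous_apply i).comp (Continuous.matrix_mulVec continuous_const hy)
  have h1 : flow A (t - b) ξ ⬝ᵥ (y b - y a) - flow A (t - b) ξ ⬝ᵥ (w b - w a)
      = ∫ s in a..b, A.mulVec (flow A (t - b) ξ) ⬝ᵥ y s := by
    have h2 : ∀ i, (y b - y a) i - (w b - w a) i
        = ∫ r in a..b, A.transpose.mulVec (y r) i := by
      intro i
      rw [← intervalIntegral.integral_interval_sub_left
        ((hcont i).intervalIntegrable 0 b) ((hcont i).intervalIntegrable 0 a)]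
      simp only [Pi.sub_apply, hyw b (ha.trans hab) i, hyw a ha i]
      ring
    rw [← dotProduct_sub]
    have h3 : y b - y a - (w b - w a) = fun i => ∫ r in a..b, A.transpose.mulVec (y r) i :=
      funext h2
    rw [h3]
    simp only [dotProduct]
    have h4 : ∀ s, ∑ i, A.mulVec (flow A (t - b) ξ) i * y s i
        = ∑ i, flow A (t - b) ξ i * A.transpose.mulVec (y s) i := by
      intro s
      change A.mulVec (flow A (t - b) ξ) ⬝ᵥ y s = flow A (t - b) ξ ⬝ᵥ A.transpose.mulVec (y s)
      rw [Matrix.dotProduct_mulVec, Matrix.vecMul_transpose]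
    simp only [h4]
    rw [intervalIntegral.integral_finsetSum]
    · simp only [intervalIntegral.integral_const_mul]
    · intro i _
      exact ((hcont i).const_mul _).intervalIntegrable _ _
  have h5 : (flow A (t - b) ξ - flow A (t - a) ξ) ⬝ᵥ y a
      = ∫ s in a..b, -(A.mulVec (flow A (t - s) ξ) ⬝ᵥ y a) := by
    rw [intervalIntegral.integral_eq_sub_of_hasDerivAt
      (f := fun s => flow A (t - s) ξ ⬝ᵥ y a)]
    · rw [sub_dotProduct]
    · intro s _
      have := (hasDerivAt_flow A ξ (t - s)).scomp s ((hasDerivAt_id s).const_sub t)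
      have h6 := hasDerivAt_dotProduct this (hasDerivAt_const s (y a))
      simpa using h6
    · refine Continuous.intervalIntegrable ?_ _ _
      unfold Matrix.mulVec dotProduct
      fun_prop
  have h7 : flow A (t - b) ξ ⬝ᵥ y b - flow A (t - a) ξ ⬝ᵥ y a
      - flow A (t - b) ξ ⬝ᵥ (w b - w a)
      = ∫ s in a..b, (A.mulVec (flow A (t - b) ξ) ⬝ᵥ y s
          + -(A.mulVec (flow A (t - s) ξ) ⬝ᵥ y a)) := by
    rw [intervalIntegral.integral_add, ← h1, ← h5]
    · simp only [dotProduct_sub, sub_dotProduct]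
      ring
    · refine Continuous.intervalIntegrable ?_ _ _
      unfold dotProduct
      fun_prop
    · refine Continuous.intervalIntegrable ?_ _ _
      unfold Matrix.mulVec dotProduct
      fun_prop
  rw [h7, ← Real.norm_eq_abs, ← abs_of_nonneg (sub_nonneg.2 hab)]
  refine intervalIntegral.norm_integral_le_of_norm_le_const fun s hs => ?_
  rw [Set.uIoc_of_le hab] at hs
  rw [Real.norm_eq_abs, ← sub_eq_add_neg]
  exact hε s ⟨hs.1.le, hs.2⟩

/-- The Riemann sums of the stochastic convolution in the variation of constants formula converge
along every continuous path. -/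
lemma tendsto_variation_of_constants (A : Matrix ι ι ℝ) (ξ : ι → ℝ) {y w : ℝ → ι → ℝ} {z : ι → ℝ}
    (hy : Continuous y) (hy0 : y 0 = z) {t : ℝ} (ht : 0 ≤ t)
    (hyw : ∀ s, 0 ≤ s → ∀ i,
      y s i = z i + (∫ r in (0 : ℝ)..s, A.transpose.mulVec (y r) i) + w s i) :
    Filter.Tendsto (fun n : ℕ => ∑ k ∈ Finset.range (n + 1),
        flow A (t - (k + 1 : ℕ) * (t / (n + 1 : ℕ))) ξ ⬝ᵥ
          (w ((k + 1 : ℕ) * (t / (n + 1 : ℕ))) - w (k * (t / (n + 1 : ℕ)))))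
      Filter.atTop (nhds (ξ ⬝ᵥ y t - flow A t ξ ⬝ᵥ z)) := by
  have hF : Continuous fun p : ℝ × ℝ => A.mulVec (flow A (t - p.1) ξ) ⬝ᵥ y p.2 := by
    unfold Matrix.mulVec dotProduct
    fun_prop
  have hU := ((isCompact_Icc (a := (0 : ℝ)) (b := t)).prod
    (isCompact_Icc (a := (0 : ℝ)) (b := t))).uniformContinuousOn_of_continuous hF.continuousOn
  rw [Metric.uniformContinuousOn_iff] at hU
  rw [Metric.tendsto_atTop]
  intro ε hε
  obtain ⟨δ, hδ, hU⟩ := hU (ε / (t + 1)) (by positivity)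
  obtain ⟨n₀, hn₀⟩ := exists_nat_gt (t / δ)
  refine ⟨n₀, fun n hn => ?_⟩
  set h : ℝ := t / (n + 1 : ℕ) with hh
  have hn1 : (0 : ℝ) < (n + 1 : ℕ) := by positivity
  have hh0 : 0 ≤ h := by positivity
  have hnh : (n + 1 : ℕ) * h = t := by rw [hh]; field_simp
  have hhδ : h < δ := by
    rw [hh, div_lt_iff₀ hn1]
    rw [div_lt_iff₀ hδ] at hn₀
    have : (n₀ : ℝ) ≤ (n + 1 : ℕ) := by exact_mod_cast hn.trans (Nat.le_succ n)
    nlinarith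
  set S : ℕ → ℝ := fun k => flow A (t - k * h) ξ ⬝ᵥ y (k * h) with hS
  have htel : ξ ⬝ᵥ y t - flow A t ξ ⬝ᵥ z = ∑ k ∈ Finset.range (n + 1), (S (k + 1) - S k) := by
    rw [Finset.sum_range_sub]
    simp only [hS, hnh]
    simp [hy0]
  rw [dist_comm, Real.dist_eq, htel, ← Finset.sum_sub_distrib]
  calc _ ≤ ∑ k ∈ Finset.range (n + 1), ε / (t + 1) * h := by
        refine (Finset.abs_sum_le_sum_abs _ _).trans (Finset.sum_le_sum fun k hk => ?_)
        have hk' : (k + 1 : ℕ) * h ≤ t := by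
          rw [← hnh]
          have : ((k + 1 : ℕ) : ℝ) ≤ (n + 1 : ℕ) := by
            exact_mod_cast Finset.mem_range.1 hk
          gcongr
        have hkk : ((k + 1 : ℕ) : ℝ) * h - k * h = h := by push_cast; ring
        have hk0 : 0 ≤ (k : ℝ) * h := by positivity
        have hstep := abs_variation_step_le A ξ (w := w) (z := z) hy (a := k * h)
          (b := (k + 1 : ℕ) * h) (t := t) (ε := ε / (t + 1)) hk0 (by linarith) hyw ?_
        · rw [hkk] at hstep
          exact hstep
        · intro s hs
          have := hU (((k + 1 : ℕ) * h), s) ⟨⟨by linarith, hk'⟩, ⟨by linarith [hs.1], hs.2.trans hk'⟩⟩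
            (s, k * h) ⟨⟨by linarith [hs.1], hs.2.trans hk'⟩, ⟨by linarith, by linarith⟩⟩ ?_
          · rw [Real.dist_eq] at this
            exact this.le
          · rw [Prod.dist_eq, Real.dist_eq, Real.dist_eq, max_lt_iff, abs_lt, abs_lt]
            have h1 := hs.1
            have h2 := hs.2
            refine ⟨⟨?_, ?_⟩, ⟨?_, ?_⟩⟩ <;> simp only <;> linarith
    _ = ε / (t + 1) * t := by
        rw [Finset.sum_const, Finset.card_range, nsmul_eq_mul, ← mul_assoc, mul_comm _ (ε / (t + 1)),
          mul_assoc, hnh]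
    _ < ε := by
        rw [div_mul_eq_mul_div, div_lt_iff₀ (by positivity)]
        nlinarith

end Flow

section Gaussian

lemma tendsto_riemann_sum {f : ℝ → ℝ} (hf : Continuous f) {t : ℝ} (ht : 0 ≤ t) :
    Filter.Tendsto (fun n : ℕ => ∑ k ∈ Finset.range (n + 1),
        f ((k + 1 : ℕ) * (t / (n + 1 : ℕ))) * (t / (n + 1 : ℕ)))
      Filter.atTop (nhds (∫ s in (0 : ℝ)..t, f s)) := by
  have hU := (isCompact_Icc (a := (0 : ℝ)) (b := t)).uniformContinuousOn_of_continuous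
    hf.continuousOn
  rw [Metric.uniformContinuousOn_iff] at hU
  rw [Metric.tendsto_atTop]
  intro ε hε
  obtain ⟨δ, hδ, hU⟩ := hU (ε / (t + 1)) (by positivity)
  obtain ⟨n₀, hn₀⟩ := exists_nat_gt (t / δ)
  refine ⟨n₀, fun n hn => ?_⟩
  set h : ℝ := t / (n + 1 : ℕ) with hh
  have hn1 : (0 : ℝ) < (n + 1 : ℕ) := by positivity
  have hh0 : 0 ≤ h := by positivity
  have hnh : (n + 1 : ℕ) * h = t := by rw [hh]; field_simp
  have hhδ : h < δ := by
    rw [hh, div_lt_iff₀ hn1]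
    rw [div_lt_iff₀ hδ] at hn₀
    have : (n₀ : ℝ) ≤ (n + 1 : ℕ) := by exact_mod_cast hn.trans (Nat.le_succ n)
    nlinarith
  have hsum : (∫ s in (0 : ℝ)..t, f s)
      = ∑ k ∈ Finset.range (n + 1), ∫ s in ((k : ℝ) * h)..((k + 1 : ℕ) * h), f s := by
    have := intervalIntegral.sum_integral_adjacent_intervals (f := f) (μ := volume)
      (a := fun k : ℕ => (k : ℝ) * h) (n := n + 1) fun k _ => hf.intervalIntegrable _ _
    rw [this, hnh]
    simp
  rw [Real.dist_eq, hsum, ← Finset.sum_sub_distrib]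
  calc _ ≤ ∑ k ∈ Finset.range (n + 1), ε / (t + 1) * h := by
        refine (Finset.abs_sum_le_sum_abs _ _).trans (Finset.sum_le_sum fun k hk => ?_)
        have hk' : (k + 1 : ℕ) * h ≤ t := by
          rw [← hnh]
          have : ((k + 1 : ℕ) : ℝ) ≤ (n + 1 : ℕ) := by
            exact_mod_cast Finset.mem_range.1 hk
          gcongr
        have hkk : ((k + 1 : ℕ) : ℝ) * h - k * h = h := by push_cast; ring
        have hk0 : 0 ≤ (k : ℝ) * h := by positivity
        have hc : f ((k + 1 : ℕ) * h) * h
            = ∫ s in ((k : ℝ) * h)..((k + 1 : ℕ) * h), f ((k + 1 : ℕ) * h) := by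
          rw [intervalIntegral.integral_const, hkk, smul_eq_mul, mul_comm]
        rw [hc, ← intervalIntegral.integral_sub (by simp) (hf.intervalIntegrable _ _),
          ← Real.norm_eq_abs]
        refine (intervalIntegral.norm_integral_le_of_norm_le_const (C := ε / (t + 1))
          fun s hs => ?_).trans_eq ?_
        · rw [Set.uIoc_of_le (by linarith)] at hs
          have h1 := hs.1
          have h2 := hs.2
          refine (hU _ ⟨by linarith, hk'⟩ s ⟨by linarith, by linarith⟩ ?_).le
          rw [Real.dist_eq, abs_lt]
          constructor <;> linarith
        · rw [hkk, abs_of_nonneg hh0]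
    _ = ε / (t + 1) * t := by
        rw [Finset.sum_const, Finset.card_range, nsmul_eq_mul, ← mul_assoc, mul_comm _ (ε / (t + 1)),
          mul_assoc, hnh]
    _ < ε := by
        rw [div_mul_eq_mul_div, div_lt_iff₀ (by positivity)]
        nlinarith

variable {Ω : Type*} [MeasurableSpace Ω] {P : Measure Ω}

lemma charFun_brownian_increments {X : ℝ≥0 → Ω → ℝ} (hX : IsBrownianReal X P)
    (c : ℕ → ℝ) (h : ℝ≥0) (n : ℕ) (u : ℝ) :
    charFun (P.map fun ω => ∑ k ∈ Finset.range n,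
        c k * (X ((k + 1 : ℕ) * h) ω - X (k * h) ω)) u
      = Complex.exp ((-(∑ k ∈ Finset.range n, c k ^ 2 * h) * u ^ 2 / 2 : ℝ)) := by
  have hprob : IsProbabilityMeasure P := hX.isGaussianProcess.isProbabilityMeasure
  have hmono : Monotone fun k : ℕ => (k : ℝ≥0) * h := fun a b hab => by
    have : (a : ℝ≥0) ≤ b := by exact_mod_cast hab
    exact mul_le_mul_left this h
  have hind := (hX.hasIndepIncrements.nat hmono).comp (fun k x => c k * x) (by fun_prop)
  rw [iIndepFun.charFun_map_fun_finsetSum_eq_prod (X := fun k ω =>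
    c k * (X ((k + 1 : ℕ) * h) ω - X (k * h) ω)) _ (hind.restrict _)]
  · rw [Finset.prod_apply]
    have : ∀ k, charFun (P.map fun ω => c k * (X ((k + 1 : ℕ) * h) ω - X (k * h) ω)) u
        = Complex.exp ((-(c k ^ 2 * h) * u ^ 2 / 2 : ℝ)) := by
      intro k
      have h1 := (hX.hasLaw_sub ((k + 1 : ℕ) * h) (k * h)).map_eq
      refine (charFun_map_mul_comp (f := X ((k + 1 : ℕ) * h) - X (k * h))
        ((hX.aemeasurable _).sub (hX.aemeasurable _)) (c k) u).trans ?_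
      rw [h1, charFun_gaussianReal]
      have h2 : nndist ((k + 1 : ℕ) * h : ℝ≥0).1 (k * h : ℝ≥0).1 = h := by
        apply NNReal.coe_injective
        rw [coe_nndist, Real.dist_eq]
        change |((((k + 1 : ℕ) * h : ℝ≥0) : ℝ)) - ((k * h : ℝ≥0) : ℝ)| = h
        push_cast
        rw [show ((k : ℝ) + 1) * h - k * h = h by ring, abs_of_nonneg h.coe_nonneg]
      rw [h2]
      push_cast
      congr 1
      ring
    rw [Finset.prod_congr rfl fun k _ => this k, ← Complex.exp_sum, ← Complex.ofReal_sum]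
    congr 2
    rw [← Finset.sum_div, ← Finset.sum_mul, Finset.sum_neg_distrib]
  · intro k _
    exact ((hX.aemeasurable _).sub (hX.aemeasurable _)).const_mul _

lemma charFun_brownianFamily_increments {ι : Type*} [Fintype ι] {B : ι → ℝ≥0 → Ω → ℝ}
    (hB : IsBrownianFamily P B) [IsProbabilityMeasure P] (c : ι → ℕ → ℝ) (h : ℝ≥0) (n : ℕ) (u : ℝ) :
    charFun (P.map fun ω => ∑ i, ∑ k ∈ Finset.range n,
        c i k * (B i ((k + 1 : ℕ) * h) ω - B i (k * h) ω)) u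
      = Complex.exp ((-(∑ i, ∑ k ∈ Finset.range n, c i k ^ 2 * h) * u ^ 2 / 2 : ℝ)) := by
  have hind := hB.indep.comp (fun i (x : ℝ≥0 → ℝ) => ∑ k ∈ Finset.range n,
    c i k * (x ((k + 1 : ℕ) * h) - x (k * h))) (by fun_prop)
  rw [iIndepFun.charFun_map_fun_sum_eq_prod (X := fun i ω => ∑ k ∈ Finset.range n,
    c i k * (B i ((k + 1 : ℕ) * h) ω - B i (k * h) ω)) _ hind]
  · rw [Finset.prod_apply]
    simp only [charFun_brownian_increments (hB.brownian _)]
    rw [← Complex.exp_sum, ← Complex.ofReal_sum]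
    congr 2
    rw [← Finset.sum_div, ← Finset.sum_mul, Finset.sum_neg_distrib]
  · intro i
    refine Finset.aemeasurable_fun_sum _ fun k _ => ?_
    exact (((hB.brownian i).aemeasurable _).sub ((hB.brownian i).aemeasurable _)).const_mul _

/-- The characteristic function of an almost sure limit. -/
lemma tendsto_integral_exp_mul_I [IsProbabilityMeasure P] {S : ℕ → Ω → ℝ} {X : Ω → ℝ}
    (hS : ∀ n, AEMeasurable (S n) P)
    (hlim : ∀ᵐ ω ∂P, Filter.Tendsto (fun n => S n ω) Filter.atTop (nhds (X ω))) :
    Filter.Tendsto (fun n => ∫ ω, Complex.exp (S n ω * Complex.I) ∂P) Filter.atTop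
      (nhds (∫ ω, Complex.exp (X ω * Complex.I) ∂P)) := by
  refine tendsto_integral_of_dominated_convergence (fun _ => 1) (fun n => ?_) (by simp) ?_ ?_
  · have : Continuous fun x : ℝ => Complex.exp (x * Complex.I) := by fun_prop
    exact this.comp_aestronglyMeasurable (hS n).aestronglyMeasurable
  · intro n
    filter_upwards with ω
    rw [Complex.norm_exp_ofReal_mul_I]
  · filter_upwards [hlim] with ω hω
    have : Continuous fun x : ℝ => Complex.exp (x * Complex.I) := by fun_prop
    exact (this.tendsto _).comp hω

end Gaussian

section CharFun

variable {ι : Type*} [Fintype ι]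

/-- The characteristic function of a measure on `ι → ℝ`, for the pairing given by the dot
product. -/
noncomputable def dotCharFun (μ : Measure (ι → ℝ)) (ξ : ι → ℝ) : ℂ :=
  ∫ x, Complex.exp ((ξ ⬝ᵥ x : ℝ) * Complex.I) ∂μ

/-- The dot product with `ξ` as a continuous linear form. -/
noncomputable def dotDual (ξ : ι → ℝ) : StrongDual ℝ (ι → ℝ) :=
  ∑ i, ξ i • ContinuousLinearMap.proj i

lemma dotDual_apply (ξ x : ι → ℝ) : dotDual ξ x = ξ ⬝ᵥ x := by
  simp [dotDual, dotProduct]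

lemma dotCharFun_eq_charFunDual (μ : Measure (ι → ℝ)) (ξ : ι → ℝ) :
    dotCharFun μ ξ = charFunDual μ (dotDual ξ) := by
  simp [charFunDual_apply, dotCharFun, dotDual_apply]

lemma ext_of_dotCharFun {μ ν : Measure (ι → ℝ)} [IsFiniteMeasure μ] [IsFiniteMeasure ν]
    (h : ∀ ξ, dotCharFun μ ξ = dotCharFun ν ξ) : μ = ν := by
  classical
  refine Measure.ext_of_charFunDual (funext fun L => ?_)
  have hL : L = dotDual fun i => L (Pi.single i 1) := by
    ext v
    rw [dotDual_apply, dotProduct_comm]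
    have := LinearMap.pi_apply_eq_sum_univ (L : (ι → ℝ) →ₗ[ℝ] ℝ) v
    simpa [dotProduct, ← Pi.single_apply, Pi.single_comm] using this
  rw [hL, ← dotCharFun_eq_charFunDual, ← dotCharFun_eq_charFunDual, h]

lemma dotCharFun_map {Ω : Type*} [MeasurableSpace Ω] {P : Measure Ω} {X : Ω → ι → ℝ}
    (hX : AEMeasurable X P) (ξ : ι → ℝ) :
    dotCharFun (P.map X) ξ = ∫ ω, Complex.exp ((ξ ⬝ᵥ X ω : ℝ) * Complex.I) ∂P := by
  rw [dotCharFun, integral_map hX]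
  refine Continuous.aestronglyMeasurable ?_
  unfold dotProduct
  fun_prop

lemma dotCharFun_conv (μ ν : Measure (ι → ℝ)) [IsFiniteMeasure μ] [IsFiniteMeasure ν]
    (ξ : ι → ℝ) : dotCharFun (μ.conv ν) ξ = dotCharFun μ ξ * dotCharFun ν ξ := by
  simp only [dotCharFun_eq_charFunDual, charFunDual_conv]

lemma dotCharFun_map_const_add (μ : Measure (ι → ℝ)) (a ξ : ι → ℝ) :
    dotCharFun (μ.map (a + ·)) ξ = dotCharFun μ ξ * Complex.exp ((ξ ⬝ᵥ a : ℝ) * Complex.I) := by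
  simp only [dotCharFun_eq_charFunDual, charFunDual_map_const_add, dotDual_apply]

lemma dotCharFun_map_adjointFlow [DecidableEq ι] (A : Matrix ι ι ℝ) (t : ℝ)
    (μ : Measure (ι → ℝ)) (ξ : ι → ℝ) :
    dotCharFun (μ.map (adjointFlow A t)) ξ = dotCharFun μ (flow A t ξ) := by
  rw [dotCharFun_map (by fun_prop)]
  simp only [dotProduct_adjointFlow, dotCharFun]

lemma continuous_dotCharFun (μ : Measure (ι → ℝ)) [IsFiniteMeasure μ] :
    Continuous (dotCharFun μ) := by
  unfold dotCharFun
  refine continuous_of_dominated (bound := fun _ => 1) (fun ξ => ?_) (fun ξ => ?_) (by simp) ?_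
  · refine Continuous.aestronglyMeasurable ?_
    unfold dotProduct
    fun_prop
  · filter_upwards with x
    rw [Complex.norm_exp_ofReal_mul_I]
  · filter_upwards with x
    unfold dotProduct
    fun_prop

@[simp] lemma dotCharFun_zero (μ : Measure (ι → ℝ)) [IsProbabilityMeasure μ] :
    dotCharFun μ 0 = 1 := by
  simp [dotCharFun]

end CharFun

section Transition

variable {𝒱 : Type*} [Fintype 𝒱] [DecidableEq 𝒱] (G : SimpleGraph 𝒱) [DecidableRel G.Adj]

/-- The flow of the transpose of the drift matrix. -/
noncomputable def dualFlow (D : Finset 𝒱) (t : ℝ) : Phase 𝒱 →L[ℝ] Phase 𝒱 :=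
  flow (driftMatrix G D).transpose t

/-- The squared norm of the transpose of the diffusion matrix applied to `ξ`. -/
def noiseRate (bd : Finset 𝒱) (T : 𝒱 → ℝ) (ξ : Phase 𝒱) : ℝ :=
  ∑ i ∈ bd, 2 * T i * ξ (Sum.inr i) ^ 2

/-- The variance at time `t`, in the direction `ξ`, of the network started from a point. -/
noncomputable def transitionVariance (D bd : Finset 𝒱) (T : 𝒱 → ℝ) (t : ℝ) (ξ : Phase 𝒱) : ℝ :=
  ∫ s in (0 : ℝ)..t, noiseRate bd T (dualFlow G D s ξ)

lemma dotProduct_noise_sub (bd : Finset 𝒱) (T : 𝒱 → ℝ) (v : Phase 𝒱) (w w' : bd → ℝ) :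
    v ⬝ᵥ (noise bd T w - noise bd T w')
      = ∑ i : bd, Real.sqrt (2 * T i) * v (Sum.inr i) * (w i - w' i) := by
  simp only [dotProduct, Fintype.sum_sum_type, noise, Pi.sub_apply, Sum.elim_inl, Sum.elim_inr,
    sub_self, mul_zero, Finset.sum_const_zero, zero_add]
  rw [← Finset.sum_subset (Finset.subset_univ bd), ← Finset.sum_coe_sort]
  · refine Finset.sum_congr rfl fun i _ => ?_
    simp only [i.2, dite_true]
    ring
  · intro i _ hi
    simp [hi]

variable {G} {D bd : Finset 𝒱} {T : 𝒱 → ℝ} {Ω : Type*} [MeasurableSpace Ω] {P : Measure Ω}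
  [IsProbabilityMeasure P] {B : bd → ℝ≥0 → Ω → ℝ}

/-- The transition probabilities of the network are Gaussian. -/
lemma dotCharFun_transition (hT : ∀ i ∈ bd, 0 ≤ T i) (hB : IsBrownianFamily P B) {z : Phase 𝒱}
    {Y : ℝ≥0 → Ω → Phase 𝒱} (hY : IsSolution G P harmonic harmonic D bd T B z Y) (t : ℝ≥0)
    (ξ : Phase 𝒱) :
    dotCharFun (P.map (Y t)) ξ = Complex.exp ((dualFlow G D t ξ ⬝ᵥ z : ℝ) * Complex.I)
      * Complex.exp ((-transitionVariance G D bd T t ξ / 2 : ℝ)) := by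
  set A := (driftMatrix G D).transpose with hA
  set x : ℝ → Phase 𝒱 := fun s => flow A s ξ with hx
  set c : ℕ → bd → ℕ → ℝ := fun n i k => Real.sqrt (2 * T i)
    * x (t - (k + 1 : ℕ) * (t / (n + 1 : ℕ))) (Sum.inr i) with hc
  set h : ℕ → ℝ≥0 := fun n => t / (n + 1 : ℕ) with hh
  set S : ℕ → Ω → ℝ := fun n ω => ∑ i, ∑ k ∈ Finset.range (n + 1),
    c n i k * (B i ((k + 1 : ℕ) * h n) ω - B i (k * h n) ω) with hS
  have hSm : ∀ n, AEMeasurable (S n) P := fun n =>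
    Finset.aemeasurable_fun_sum _ fun i _ => Finset.aemeasurable_fun_sum _ fun k _ =>
      (((hB.brownian i).aemeasurable _).sub ((hB.brownian i).aemeasurable _)).const_mul _
  have hlim : ∀ᵐ ω ∂P, Filter.Tendsto (fun n => S n ω) Filter.atTop
      (nhds (ξ ⬝ᵥ Y t ω - x t ⬝ᵥ z)) := by
    have hB0 : ∀ᵐ ω ∂P, ∀ i, B i 0 ω = 0 :=
      ae_all_iff.2 fun i => (hB.brownian i).eval_zero_ae_eq_zero
    filter_upwards [hY.continuous_paths, hY.integral_eq, hB0] with ω hω1 hω2 hω3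
    have hw0 : noise bd T (fun i => B i 0 ω) = 0 := by
      ext a
      rcases a with a | a <;> simp [noise, hω3]
    have key := tendsto_variation_of_constants A ξ (y := fun s => Y s.toNNReal ω)
      (w := fun s => noise bd T (fun i => B i s.toNNReal ω)) (z := z) (t := t)
      (hω1.comp continuous_real_toNNReal) ?_ t.coe_nonneg ?_
    · simp only [Real.toNNReal_coe] at key
      refine key.congr fun n => ?_
      have hcast : ∀ k : ℕ, ((k : ℝ) * ((t : ℝ) / (n + 1 : ℕ))).toNNReal = k * h n := by
        intro k
        rw [← Real.toNNReal_coe (r := k * h n)]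
        simp [hh]
      simp only [hcast, dotProduct_noise_sub]
      rw [Finset.sum_comm]
    · ext a
      have := hω2 0 a
      simp only [NNReal.coe_zero, intervalIntegral.integral_same, hw0] at this
      simpa using this
    · intro s hs i
      have := hω2 s.toNNReal i
      rw [Real.coe_toNNReal s hs] at this
      simp only [drift_harmonic] at this
      simpa [hA] using this
  have h1 := tendsto_integral_exp_mul_I hSm hlim
  have h2 : ∀ n, ∫ ω, Complex.exp (S n ω * Complex.I) ∂P
      = Complex.exp ((-(∑ i, ∑ k ∈ Finset.range (n + 1), c n i k ^ 2 * h n) / 2 : ℝ)) := by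
    intro n
    have := charFun_brownianFamily_increments hB (c n) (h n) (n + 1) 1
    rw [charFun_apply_real, integral_map (hSm n) (by fun_prop)] at this
    simpa using this
  have h3 : Filter.Tendsto (fun n => ∑ i, ∑ k ∈ Finset.range (n + 1), c n i k ^ 2 * h n)
      Filter.atTop (nhds (transitionVariance G D bd T t ξ)) := by
    have hcont : Continuous fun s : ℝ => noiseRate bd T (x (t - s)) := by
      unfold noiseRate
      fun_prop
    have := tendsto_riemann_sum hcont t.coe_nonneg
    rw [intervalIntegral.integral_comp_sub_left (fun s => noiseRate bd T (x s))] at this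
    simp only [sub_self, sub_zero] at this
    refine this.congr fun n => ?_
    rw [Finset.sum_comm]
    refine Finset.sum_congr rfl fun k _ => ?_
    rw [noiseRate, ← Finset.sum_coe_sort, Finset.sum_mul]
    refine Finset.sum_congr rfl fun i _ => ?_
    simp only [hc, hh, mul_pow, Real.sq_sqrt (mul_nonneg zero_le_two (hT i i.2))]
    push_cast
    ring
  have h4 : Filter.Tendsto (fun n => Complex.exp
      ((-(∑ i, ∑ k ∈ Finset.range (n + 1), c n i k ^ 2 * h n) / 2 : ℝ))) Filter.atTop
      (nhds (Complex.exp ((-transitionVariance G D bd T t ξ / 2 : ℝ)))) := by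
    have : Continuous fun v : ℝ => Complex.exp ((-v / 2 : ℝ)) := by fun_prop
    exact (this.tendsto _).comp h3
  simp only [h2] at h1
  rw [dotCharFun_map (hY.aemeasurable t), tendsto_nhds_unique h4 h1, ← integral_const_mul]
  refine integral_congr_ae (Filter.Eventually.of_forall fun ω => ?_)
  simp only
  rw [← Complex.exp_add]
  congr 1
  simp only [hx, dualFlow, ← hA]
  push_cast
  ring

/-- Invariance of a measure, in terms of its characteristic function. -/
lemma isInvariant_iff (hT : ∀ i ∈ bd, 0 ≤ T i) (hB : IsBrownianFamily P B)
    {Z : Phase 𝒱 → ℝ≥0 → Ω → Phase 𝒱}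
    (hZ : ∀ z, IsSolution G P harmonic harmonic D bd T B z (Z z))
    (μ : Measure (Phase 𝒱)) [IsProbabilityMeasure μ] :
    IsInvariant P Z μ ↔ ∀ (t : ℝ≥0) (ξ : Phase 𝒱), dotCharFun μ ξ
      = dotCharFun μ (dualFlow G D t ξ)
        * Complex.exp ((-transitionVariance G D bd T t ξ / 2 : ℝ)) := by
  unfold IsInvariant
  refine forall_congr' fun t => ?_
  set ν := P.map (Z 0 t) with hν
  have hνp : IsProbabilityMeasure ν := Measure.isProbabilityMeasure_map ((hZ 0).aemeasurable t)
  set Φ := adjointFlow (driftMatrix G D).transpose t with hΦ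
  have htr : ∀ z, P.map (Z z t) = ν.map (Φ z + ·) := by
    intro z
    have : IsProbabilityMeasure (P.map (Z z t)) :=
      Measure.isProbabilityMeasure_map ((hZ z).aemeasurable t)
    refine ext_of_dotCharFun fun ξ => ?_
    rw [dotCharFun_map_const_add, dotCharFun_transition hT hB (hZ z),
      dotCharFun_transition hT hB (hZ 0), dotProduct_adjointFlow]
    simp [dualFlow, mul_comm]
  have hconv : ∀ A, MeasurableSet A → ∫⁻ z, (P.map (Z z t)) A ∂μ = ((μ.map Φ).conv ν) A := by
    intro A hA
    rw [← lintegral_indicator_one hA, Measure.lintegral_conv (measurable_one.indicator hA),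
      lintegral_map _ (by fun_prop)]
    · refine lintegral_congr fun z => ?_
      rw [htr, Measure.map_apply (by fun_prop) hA, ← lintegral_indicator_one
        ((measurable_const_add _) hA)]
      rfl
    · exact ((measurable_one.indicator hA).comp measurable_add).lintegral_prod_right'
  have hm : IsProbabilityMeasure (μ.map Φ) := Measure.isProbabilityMeasure_map (by fun_prop)
  have hcf : ∀ ξ, dotCharFun ((μ.map Φ).conv ν) ξ = dotCharFun μ (dualFlow G D t ξ)
      * Complex.exp ((-transitionVariance G D bd T t ξ / 2 : ℝ)) := by
    intro ξ
    rw [dotCharFun_conv, dotCharFun_map_adjointFlow, dotCharFun_transition hT hB (hZ 0)]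
    simp [dualFlow]
  constructor
  · intro h ξ
    have : (μ.map Φ).conv ν = μ := Measure.ext fun A hA => by rw [← hconv A hA, h A hA]
    rw [← hcf, this]
  · intro h A hA
    rw [hconv A hA, ext_of_dotCharFun fun ξ => (hcf ξ).trans (h ξ).symm]

end Transition

section Energy

variable {𝒱 : Type*} [Fintype 𝒱] [DecidableEq 𝒱] (G : SimpleGraph 𝒱) [DecidableRel G.Adj]

lemma posDef_Gam : (Gam G).PosDef :=
  Matrix.PosDef.one.add_posSemidef (G.posSemidef_lapMatrix ℝ)

lemma transpose_Gam : (Gam G).transpose = Gam G := by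
  have := (posDef_Gam G).1
  rwa [Matrix.IsHermitian, Matrix.conjTranspose_eq_transpose_of_trivial] at this

lemma dotProduct_Gam_mulVec (u v : 𝒱 → ℝ) :
    (Gam G).mulVec u ⬝ᵥ v = u ⬝ᵥ (Gam G).mulVec v := by
  rw [Matrix.dotProduct_mulVec, ← Matrix.mulVec_transpose, transpose_Gam]

variable (D : Finset 𝒱)

lemma transpose_driftMatrix_mulVec_inl (ξ : Phase 𝒱) (i : 𝒱) :
    (driftMatrix G D).transpose.mulVec ξ (Sum.inl i)
      = -(Gam G).mulVec (fun j => ξ (Sum.inr j)) i := by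
  rw [driftMatrix, Matrix.fromBlocks_transpose, Matrix.fromBlocks_mulVec]
  simp [transpose_Gam, Matrix.neg_mulVec, Function.comp_def]

lemma transpose_driftMatrix_mulVec_inr (ξ : Phase 𝒱) (i : 𝒱) :
    (driftMatrix G D).transpose.mulVec ξ (Sum.inr i)
      = ξ (Sum.inl i) - if i ∈ D then ξ (Sum.inr i) else 0 := by
  rw [driftMatrix, Matrix.fromBlocks_transpose, Matrix.fromBlocks_mulVec]
  simp [Matrix.neg_mulVec, Matrix.mulVec_diagonal, ← sub_eq_add_neg]

/-- Twice the energy of the dual system. -/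
noncomputable def dualEnergy (ξ : Phase 𝒱) : ℝ :=
  (fun i => ξ (Sum.inl i)) ⬝ᵥ (Gam G)⁻¹.mulVec (fun i => ξ (Sum.inl i))
    + (fun i => ξ (Sum.inr i)) ⬝ᵥ (fun i => ξ (Sum.inr i))

lemma dualEnergy_pos {ξ : Phase 𝒱} (hξ : ξ ≠ 0) : 0 < dualEnergy G ξ := by
  have h1 : ∀ v : 𝒱 → ℝ, v ≠ 0 → 0 < v ⬝ᵥ (Gam G)⁻¹.mulVec v := fun v hv => by
    simpa using (posDef_Gam G).inv.dotProduct_mulVec_pos hv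
  have h2 : ∀ v : 𝒱 → ℝ, 0 ≤ v ⬝ᵥ v := fun v => Finset.sum_nonneg fun i _ => mul_self_nonneg _
  unfold dualEnergy
  by_cases ha : (fun i => ξ (Sum.inl i)) = 0
  · have hb : (fun i => ξ (Sum.inr i)) ≠ 0 := fun hb => hξ <| by
      ext a
      rcases a with a | a
      · exact congrFun ha a
      · exact congrFun hb a
    have h3 : (fun i => ξ (Sum.inr i)) ⬝ᵥ (fun i => ξ (Sum.inr i)) ≠ 0 := fun h =>
      hb (dotProduct_self_eq_zero.1 h)
    rw [ha, zero_dotProduct, zero_add]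
    exact lt_of_le_of_ne (h2 _) h3.symm
  · exact add_pos_of_pos_of_nonneg (h1 _ ha) (h2 _)

@[simp] lemma dualEnergy_zero : dualEnergy G 0 = 0 := by
  simp [dualEnergy, dotProduct]

lemma dualEnergy_nonneg (ξ : Phase 𝒱) : 0 ≤ dualEnergy G ξ := by
  rcases eq_or_ne ξ 0 with rfl | h
  · simp
  · exact (dualEnergy_pos G h).le

lemma dualEnergy_smul (c : ℝ) (ξ : Phase 𝒱) : dualEnergy G (c • ξ) = c ^ 2 * dualEnergy G ξ := by
  have h : ∀ f : 𝒱 → 𝒱 ⊕ 𝒱, (fun i => (c • ξ) (f i)) = c • fun i => ξ (f i) := fun f => rfl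
  unfold dualEnergy
  rw [h Sum.inl, h Sum.inr, Matrix.mulVec_smul]
  simp only [dotProduct_smul, smul_dotProduct, smul_eq_mul]
  ring

lemma continuous_dualEnergy : Continuous (dualEnergy G) := by
  unfold dualEnergy Matrix.mulVec dotProduct
  fun_prop

lemma hasDerivAt_dualFlow (ξ : Phase 𝒱) (t : ℝ) :
    HasDerivAt (fun s => dualFlow G D s ξ)
      ((driftMatrix G D).transpose.mulVec (dualFlow G D t ξ)) t :=
  hasDerivAt_flow _ ξ t

@[fun_prop]
lemma continuous_dualFlow_apply (ξ : Phase 𝒱) (a : 𝒱 ⊕ 𝒱) :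
    Continuous fun s => dualFlow G D s ξ a :=
  continuous_flow_apply _ ξ a

lemma dualFlow_add (s t : ℝ) (ξ : Phase 𝒱) :
    dualFlow G D (s + t) ξ = dualFlow G D s (dualFlow G D t ξ) :=
  flow_add _ s t ξ

@[simp] lemma dualFlow_zero (ξ : Phase 𝒱) : dualFlow G D 0 ξ = ξ :=
  flow_zero _ ξ

lemma hasDerivAt_dualFlow_inl (ξ : Phase 𝒱) (t : ℝ) :
    HasDerivAt (fun s i => dualFlow G D s ξ (Sum.inl i))
      (-(Gam G).mulVec fun i => dualFlow G D t ξ (Sum.inr i)) t := by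
  rw [hasDerivAt_pi]
  intro i
  have := hasDerivAt_pi.1 (hasDerivAt_dualFlow G D ξ t) (Sum.inl i)
  rwa [transpose_driftMatrix_mulVec_inl] at this

lemma hasDerivAt_dualFlow_inr (ξ : Phase 𝒱) (t : ℝ) :
    HasDerivAt (fun s i => dualFlow G D s ξ (Sum.inr i))
      (fun i => dualFlow G D t ξ (Sum.inl i)
        - if i ∈ D then dualFlow G D t ξ (Sum.inr i) else 0) t := by
  rw [hasDerivAt_pi]
  intro i
  have := hasDerivAt_pi.1 (hasDerivAt_dualFlow G D ξ t) (Sum.inr i)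
  rwa [transpose_driftMatrix_mulVec_inr] at this

lemma hasDerivAt_dualEnergy (ξ : Phase 𝒱) (t : ℝ) :
    HasDerivAt (fun s => dualEnergy G (dualFlow G D s ξ))
      (-2 * ∑ i ∈ D, dualFlow G D t ξ (Sum.inr i) ^ 2) t := by
  have ha := hasDerivAt_dualFlow_inl G D ξ t
  have hb := hasDerivAt_dualFlow_inr G D ξ t
  have hΓa : HasDerivAt (fun s => (Gam G)⁻¹.mulVec fun i => dualFlow G D s ξ (Sum.inl i))
      (-(fun i => dualFlow G D t ξ (Sum.inr i))) t := by
    have h1 := ((Matrix.toLin' (Gam G)⁻¹).toContinuousLinearMap.hasFDerivAt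
      (x := fun i => dualFlow G D t ξ (Sum.inl i))).comp_hasDerivAt t ha
    have hdet : IsUnit (Gam G).det := (posDef_Gam G).det_pos.ne'.isUnit
    simpa [Matrix.mulVec_neg, Matrix.mulVec_mulVec, Matrix.nonsing_inv_mul _ hdet,
      Function.comp_def] using h1
  refine ((hasDerivAt_dotProduct ha hΓa).add (hasDerivAt_dotProduct hb hb)).congr_deriv ?_
  have hdet : IsUnit (Gam G).det := (posDef_Gam G).det_pos.ne'.isUnit
  have hD : ∑ i ∈ D, dualFlow G D t ξ (Sum.inr i) ^ 2
      = ∑ i, if i ∈ D then dualFlow G D t ξ (Sum.inr i) ^ 2 else 0 := by simp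
  rw [neg_dotProduct, dotProduct_Gam_mulVec, Matrix.mulVec_mulVec, Matrix.mul_nonsing_inv _ hdet,
    Matrix.one_mulVec, hD]
  simp only [dotProduct, ← Finset.sum_neg_distrib, ← Finset.sum_add_distrib, Finset.mul_sum,
    Pi.neg_apply]
  refine Finset.sum_congr rfl fun i _ => ?_
  split_ifs <;> ring

lemma dualEnergy_dualFlow (ξ : Phase 𝒱) (t : ℝ) :
    dualEnergy G (dualFlow G D t ξ)
      = dualEnergy G ξ - 2 * ∫ s in (0 : ℝ)..t, ∑ i ∈ D, dualFlow G D s ξ (Sum.inr i) ^ 2 := by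
  have h := intervalIntegral.integral_eq_sub_of_hasDerivAt (a := 0) (b := t)
    (fun s _ => hasDerivAt_dualEnergy G D ξ s)
    (Continuous.intervalIntegrable (by fun_prop) _ _)
  rw [intervalIntegral.integral_const_mul, dualFlow_zero] at h
  linarith

lemma integrableOn_sum_sq (ξ : Phase 𝒱) :
    IntegrableOn (fun s => ∑ i ∈ D, dualFlow G D s ξ (Sum.inr i) ^ 2) (Set.Ioi 0) := by
  refine integrableOn_Ioi_of_intervalIntegral_norm_bounded (l := Filter.atTop) (b := id)
    (dualEnergy G ξ / 2) 0 (fun t => ?_) Filter.tendsto_id ?_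
  · exact (Continuous.integrableOn_Icc (by fun_prop)).mono_set Set.Ioc_subset_Icc_self
  · refine Filter.Eventually.of_forall fun t => ?_
    have h1 : ∀ s, ‖∑ i ∈ D, dualFlow G D s ξ (Sum.inr i) ^ 2‖
        = ∑ i ∈ D, dualFlow G D s ξ (Sum.inr i) ^ 2 := fun s =>
      Real.norm_of_nonneg (Finset.sum_nonneg fun i _ => sq_nonneg _)
    simp only [h1, id]
    have h2 := dualEnergy_dualFlow G D ξ t
    have h3 := dualEnergy_nonneg G (dualFlow G D t ξ)
    linarith

variable {D} in
lemma memLp_dualFlow_inr (ξ : Phase 𝒱) {i : 𝒱} (hi : i ∈ D) :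
    MemLp (fun s => dualFlow G D s ξ (Sum.inr i)) 2 (volume.restrict (Set.Ioi 0)) := by
  rw [memLp_two_iff_integrable_sq (Continuous.aestronglyMeasurable (by fun_prop))]
  refine (integrableOn_sum_sq G D ξ).mono' (Continuous.aestronglyMeasurable (by fun_prop)) ?_
  filter_upwards with s
  rw [Real.norm_of_nonneg (sq_nonneg _)]
  exact Finset.single_le_sum (f := fun j => dualFlow G D s ξ (Sum.inr j) ^ 2)
    (fun j _ => sq_nonneg _) hi

end Energy

section StationaryCovariance

lemma noiseRate_nonneg {𝒱 : Type*} {bd : Finset 𝒱} {T : 𝒱 → ℝ} (hT : ∀ i ∈ bd, 0 ≤ T i) (ξ : Phase 𝒱) : 0 ≤ noiseRate bd T ξ :=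
  Finset.sum_nonneg fun i hi => mul_nonneg (mul_nonneg zero_le_two (hT i hi)) (sq_nonneg _)

variable {𝒱 : Type*} [Fintype 𝒱] [DecidableEq 𝒱] (G : SimpleGraph 𝒱) [DecidableRel G.Adj]
  (D bd : Finset 𝒱) (T : 𝒱 → ℝ)

/-- The covariance matrix of the stationary network, without its undamped modes. -/
noncomputable def stationaryCov : Matrix (𝒱 ⊕ 𝒱) (𝒱 ⊕ 𝒱) ℝ := fun a b =>
  ∫ s in Set.Ioi (0 : ℝ), ∑ i ∈ bd, 2 * T i * (dualFlow G D s (Pi.single a 1) (Sum.inr i)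
    * dualFlow G D s (Pi.single b 1) (Sum.inr i))

variable {bd D}

lemma integrableOn_noiseRate (hbdD : bd ⊆ D) (ξ : Phase 𝒱) :
    IntegrableOn (fun s => noiseRate bd T (dualFlow G D s ξ)) (Set.Ioi 0) :=
  integrable_finsetSum _ fun _ hi =>
    (memLp_dualFlow_inr G ξ (hbdD hi)).integrable_sq.const_mul _

lemma dotProduct_stationaryCov_mulVec (hbdD : bd ⊆ D) (ξ : Phase 𝒱) :
    ξ ⬝ᵥ (stationaryCov G D bd T).mulVec ξ
      = ∫ s in Set.Ioi (0 : ℝ), noiseRate bd T (dualFlow G D s ξ) := by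
  have hint : ∀ a b : 𝒱 ⊕ 𝒱, Integrable (fun s => ∑ i ∈ bd, 2 * T i *
      (dualFlow G D s (Pi.single a 1) (Sum.inr i) * dualFlow G D s (Pi.single b 1) (Sum.inr i)))
      (volume.restrict (Set.Ioi 0)) := fun a b =>
    integrable_finsetSum _ fun i hi => ((memLp_dualFlow_inr G _ (hbdD hi)).integrable_mul
      (memLp_dualFlow_inr G _ (hbdD hi))).const_mul _
  have hlin : ∀ s i, dualFlow G D s ξ (Sum.inr i)
      = ∑ a, ξ a * dualFlow G D s (Pi.single a 1) (Sum.inr i) := by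
    intro s i
    have hξ : ξ = ∑ a, ξ a • Pi.single a (1 : ℝ) := by
      ext b
      simp [Finset.sum_apply, Pi.single_apply]
    conv_lhs => rw [hξ, map_sum, Finset.sum_apply]
    simp only [map_smul, Pi.smul_apply, smul_eq_mul]
  have hrate : ∀ s, noiseRate bd T (dualFlow G D s ξ) = ∑ a, ∑ b, ξ a * ξ b * ∑ i ∈ bd, 2 * T i *
      (dualFlow G D s (Pi.single a 1) (Sum.inr i)
        * dualFlow G D s (Pi.single b 1) (Sum.inr i)) := by
    intro s
    simp only [noiseRate, hlin, sq, Finset.sum_mul_sum]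
    simp only [Finset.mul_sum]
    rw [Finset.sum_comm]
    refine Finset.sum_congr rfl fun a _ => ?_
    rw [Finset.sum_comm]
    refine Finset.sum_congr rfl fun b _ => Finset.sum_congr rfl fun i _ => ?_
    ring
  simp only [hrate]
  rw [integral_finsetSum _ fun a _ =>
    integrable_finsetSum _ fun b _ => (hint a b).const_mul _]
  simp only [dotProduct, Matrix.mulVec, Finset.mul_sum]
  refine Finset.sum_congr rfl fun a _ => ?_
  rw [integral_finsetSum _ fun b _ => by
    simpa only [Finset.mul_sum] using (hint a b).const_mul (ξ a * ξ b)]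
  refine Finset.sum_congr rfl fun b _ => ?_
  simp only [← Finset.mul_sum]
  rw [integral_const_mul, stationaryCov]
  ring

variable {T} in
lemma posSemidef_stationaryCov (hbdD : bd ⊆ D) (hT : ∀ i ∈ bd, 0 ≤ T i) :
    (stationaryCov G D bd T).PosSemidef := by
  refine .of_dotProduct_mulVec_nonneg ?_ fun ξ => ?_
  · ext a b
    simp [stationaryCov, Matrix.conjTranspose_apply, mul_comm]
  · rw [star_trivial, dotProduct_stationaryCov_mulVec G T hbdD]
    exact integral_nonneg fun s => noiseRate_nonneg hT _

lemma continuous_noiseRate_dualFlow (ξ : Phase 𝒱) :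
    Continuous fun s => noiseRate bd T (dualFlow G D s ξ) := by
  unfold noiseRate
  fun_prop

lemma transitionVariance_add (s t : ℝ) (ξ : Phase 𝒱) :
    transitionVariance G D bd T (t + s) ξ = transitionVariance G D bd T t ξ
      + transitionVariance G D bd T s (dualFlow G D t ξ) := by
  have hc := continuous_noiseRate_dualFlow (bd := bd) (D := D) G T ξ
  unfold transitionVariance
  simp only [← dualFlow_add]
  rw [intervalIntegral.integral_comp_add_right (fun r => noiseRate bd T (dualFlow G D r ξ)),
    zero_add, add_comm s t, intervalIntegral.integral_add_adjacent_intervals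
      (hc.intervalIntegrable _ _) (hc.intervalIntegrable _ _)]

lemma tendsto_transitionVariance (hbdD : bd ⊆ D) (ξ : Phase 𝒱) :
    Filter.Tendsto (fun t => transitionVariance G D bd T t ξ) Filter.atTop
      (nhds (ξ ⬝ᵥ (stationaryCov G D bd T).mulVec ξ)) := by
  rw [dotProduct_stationaryCov_mulVec G T hbdD]
  exact intervalIntegral_tendsto_integral_Ioi 0 (integrableOn_noiseRate G T hbdD ξ)
    Filter.tendsto_id

/-- The Lyapunov equation in integrated form. -/
lemma stationaryCov_dualFlow (hbdD : bd ⊆ D) (t : ℝ) (ξ : Phase 𝒱) :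
    ξ ⬝ᵥ (stationaryCov G D bd T).mulVec ξ = transitionVariance G D bd T t ξ
      + dualFlow G D t ξ ⬝ᵥ (stationaryCov G D bd T).mulVec (dualFlow G D t ξ) := by
  have h1 := (tendsto_transitionVariance G T hbdD ξ).comp (Filter.tendsto_atTop_add_const_left _ t
    Filter.tendsto_id)
  have h2 := (tendsto_transitionVariance G T hbdD (dualFlow G D t ξ)).const_add
    (transitionVariance G D bd T t ξ)
  refine tendsto_nhds_unique h1 (h2.congr fun s => ?_)
  exact (transitionVariance_add G T s t ξ).symm

end StationaryCovariance

section GaussianMeasure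

/-- There is a centered Gaussian measure with a given covariance matrix. -/
lemma exists_dotCharFun_eq {ι : Type*} [Fintype ι] [DecidableEq ι] {S : Matrix ι ι ℝ}
    (hS : S.PosSemidef) : ∃ μ : ProbabilityMeasure (ι → ℝ),
      ∀ ξ, dotCharFun (μ : Measure (ι → ℝ)) ξ = Complex.exp ((-(ξ ⬝ᵥ S.mulVec ξ) / 2 : ℝ)) := by
  have hm : Measurable (WithLp.ofLp : EuclideanSpace ℝ ι → ι → ℝ) := by fun_prop
  refine ⟨⟨(multivariateGaussian 0 S).map WithLp.ofLp,
    Measure.isProbabilityMeasure_map hm.aemeasurable⟩, fun ξ => ?_⟩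
  have h := charFun_multivariateGaussian (μ := 0) hS (WithLp.toLp 2 ξ)
  rw [charFun_apply] at h
  rw [ProbabilityMeasure.coe_mk, dotCharFun_map hm.aemeasurable]
  simp only [EuclideanSpace.inner_eq_star_dotProduct, star_trivial] at h
  rw [h]
  congr 1
  simp
  ring

end GaussianMeasure

section Controllability

variable {𝒱 : Type*} [Fintype 𝒱] [DecidableEq 𝒱] (G : SimpleGraph 𝒱) [DecidableRel G.Adj]
  {D : Finset 𝒱}

lemma isAsymmetric_iff : IsAsymmetric G D ↔ controlSpace (driftMatrix G D) D = ⊤ := by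
  have hf : Module.finrank ℝ (Phase 𝒱) = 2 * Fintype.card 𝒱 := by simp [two_mul]
  rw [IsAsymmetric, ← hf]
  constructor
  · exact Submodule.eq_top_of_finrank_eq
  · intro h
    rw [h, finrank_top]

lemma dotProduct_pow_mulVec_single {ι : Type*} [Fintype ι] [DecidableEq ι] (M : Matrix ι ι ℝ)
    (k : ℕ) (ξ : ι → ℝ) (a : ι) :
    ξ ⬝ᵥ (M ^ k).mulVec (Pi.single a 1) = (M.transpose ^ k).mulVec ξ a := by
  rw [Matrix.dotProduct_mulVec, ← Matrix.transpose_pow, Matrix.mulVec_transpose]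
  simp

lemma pow_succ_mulVec {ι : Type*} [Fintype ι] [DecidableEq ι] (M : Matrix ι ι ℝ)
    (k : ℕ) (v : ι → ℝ) : (M ^ (k + 1)).mulVec v = (M ^ k).mulVec (M.mulVec v) := by
  rw [pow_succ, Matrix.mulVec_mulVec]

/-- A vector is orthogonal to the controllability space if the dual dynamics started from it is
not observed on `D`. -/
lemma forall_dotProduct_controlSpace_eq_zero {M : Matrix (𝒱 ⊕ 𝒱) (𝒱 ⊕ 𝒱) ℝ} {ξ : Phase 𝒱}
    (h : ∀ k : ℕ, ∀ i ∈ D, (M.transpose ^ k).mulVec ξ (Sum.inr i) = 0) :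
    ∀ v ∈ controlSpace M D, ξ ⬝ᵥ v = 0 := by
  intro v hv
  induction hv using Submodule.span_induction with
  | mem v hv =>
    obtain ⟨i, hi, k, rfl⟩ := hv
    rw [dotProduct_pow_mulVec_single, h k i hi]
  | zero => simp
  | add u v _ _ hu hv => rw [dotProduct_add, hu, hv, add_zero]
  | smul c v _ hv => rw [dotProduct_smul, hv, smul_zero]

lemma exists_unobservable_of_ne_top {M : Matrix (𝒱 ⊕ 𝒱) (𝒱 ⊕ 𝒱) ℝ} (h : controlSpace M D ≠ ⊤) :
    ∃ ξ : Phase 𝒱, ξ ≠ 0 ∧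
      ∀ k : ℕ, ∀ i ∈ D, (M.transpose ^ k).mulVec ξ (Sum.inr i) = 0 := by
  obtain ⟨f, hf, hker⟩ := Submodule.exists_le_ker_of_lt_top _ (lt_top_iff_ne_top.2 h)
  have hf' : ∀ v, f v = (fun a => f (Pi.single a 1)) ⬝ᵥ v := by
    intro v
    have hv : v = ∑ a, v a • Pi.single a (1 : ℝ) := by
      ext b
      simp [Finset.sum_apply, Pi.single_apply]
    conv_lhs => rw [hv, map_sum]
    simp only [map_smul, smul_eq_mul, dotProduct]
    exact Finset.sum_congr rfl fun a _ => mul_comm _ _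
  refine ⟨fun a => f (Pi.single a 1), fun h0 => hf ?_, fun k i hi => ?_⟩
  · refine LinearMap.ext fun v => ?_
    rw [hf', h0, zero_dotProduct, LinearMap.zero_apply]
  · rw [← dotProduct_pow_mulVec_single, ← hf']
    exact hker (Submodule.subset_span ⟨i, hi, k, rfl⟩)

/-- If the dual dynamics started from `ξ` is not observed on `D`, then neither are the images of its
momentum part under the powers of `Γ`. -/
lemma Gam_pow_mulVec_eq_zero {ξ : Phase 𝒱}
    (h : ∀ k : ℕ, ∀ i ∈ D,
      ((driftMatrix G D).transpose ^ k).mulVec ξ (Sum.inr i) = 0) (k : ℕ) :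
    ∀ i ∈ D, (Gam G ^ k).mulVec (fun j => ξ (Sum.inr j)) i = 0 := by
  set A := (driftMatrix G D).transpose with hA
  induction k generalizing ξ with
  | zero => intro i hi; simpa using h 0 i hi
  | succ k ih =>
    intro i hi
    have h2 : (fun j => A.mulVec (A.mulVec ξ) (Sum.inr j))
        = -(Gam G).mulVec fun j => ξ (Sum.inr j) := by
      ext j
      rw [hA, transpose_driftMatrix_mulVec_inr, transpose_driftMatrix_mulVec_inl]
      have h1 : j ∈ D → A.mulVec ξ (Sum.inr j) = 0 := fun hj => by simpa using h 1 j hj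
      split_ifs with hj
      · rw [← hA, h1 hj]
        simp
      · simp
    have h3 := ih (ξ := A.mulVec (A.mulVec ξ)) (fun k i hi => by
      rw [← pow_succ_mulVec, ← pow_succ_mulVec]
      exact h _ i hi) i hi
    rw [h2, Matrix.mulVec_neg, ← pow_succ_mulVec, Pi.neg_apply, neg_eq_zero] at h3
    exact h3

/-- The coordinate vectors all of whose images under powers of `Γ` vanish on `D`. -/
noncomputable def hiddenSpace (D : Finset 𝒱) : Submodule ℝ (EuclideanSpace ℝ 𝒱) where
  carrier := {v | ∀ k : ℕ, ∀ i ∈ D, (Gam G ^ k).mulVec v.ofLp i = 0}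
  zero_mem' := by simp
  add_mem' := by
    intro u v hu hv k i hi
    simp [Matrix.mulVec_add, hu k i hi, hv k i hi]
  smul_mem' := by
    intro c v hv k i hi
    simp [Matrix.mulVec_smul, hv k i hi]

lemma exists_eigenvector_of_not_isAsymmetric (h : ¬ IsAsymmetric G D) :
    ∃ (α : ℝ) (ζ : 𝒱 → ℝ), ζ ≠ 0 ∧ (Gam G).mulVec ζ = α • ζ ∧ ∀ i ∈ D, ζ i = 0 := by
  rw [isAsymmetric_iff] at h
  obtain ⟨ξ, hξ0, hξ⟩ := exists_unobservable_of_ne_top h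
  have hb := Gam_pow_mulVec_eq_zero G hξ
  have hξ' : ∀ k : ℕ, ∀ i ∈ D, ((driftMatrix G D).transpose ^ k).mulVec
      ((driftMatrix G D).transpose.mulVec ξ) (Sum.inr i) = 0 := fun k i hi => by
    rw [← pow_succ_mulVec]
    exact hξ _ i hi
  have ha : ∀ k : ℕ, ∀ i ∈ D, (Gam G ^ k).mulVec (fun j => ξ (Sum.inl j)) i = 0 := by
    have h1 := Gam_pow_mulVec_eq_zero G hξ'
    have h2 : (fun j => (driftMatrix G D).transpose.mulVec ξ (Sum.inr j))
        = fun j => ξ (Sum.inl j) := by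
      ext j
      rw [transpose_driftMatrix_mulVec_inr]
      split_ifs with hj
      · have : ξ (Sum.inr j) = 0 := by simpa using hξ 0 j hj
        rw [this, sub_zero]
      · rw [sub_zero]
    rwa [h2] at h1
  have hsymm : (Matrix.toEuclideanLin (Gam G)).IsSymmetric :=
    Matrix.isSymmetric_toEuclideanLin_iff.2 (posDef_Gam G).1
  have hinv : ∀ v ∈ hiddenSpace G D, Matrix.toEuclideanLin (Gam G) v ∈ hiddenSpace G D := by
    intro v hv k i hi
    simp only [Matrix.toLpLin_apply, ← pow_succ_mulVec]
    exact hv _ i hi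
  have hnt : ¬ Subsingleton (hiddenSpace G D) := by
    intro hs
    apply hξ0
    have h1 : ∀ v : 𝒱 → ℝ, (∀ k : ℕ, ∀ i ∈ D, (Gam G ^ k).mulVec v i = 0) → v = 0 := by
      intro v hv
      have := hs.elim (⟨WithLp.toLp 2 v, hv⟩ : hiddenSpace G D) 0
      simpa using congrArg (fun w : hiddenSpace G D => (w : EuclideanSpace ℝ 𝒱).ofLp) this
    ext a
    rcases a with a | a
    · exact congrFun (h1 _ ha) a
    · exact congrFun (h1 _ hb) a
  have hex : ∃ α, Module.End.eigenspace
      ((Matrix.toEuclideanLin (Gam G)).restrict hinv) α ≠ ⊥ := by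
    by_contra! hall
    exact hnt ((hsymm.restrict_invariant hinv).subsingleton_of_no_eigenvalue_finiteDimensional hall)
  obtain ⟨α, hα⟩ := hex
  obtain ⟨v, hv, hv0⟩ := Submodule.exists_mem_ne_zero_of_ne_bot hα
  rw [Module.End.mem_eigenspace_iff] at hv
  refine ⟨α, (v : EuclideanSpace ℝ 𝒱).ofLp, fun h0 => hv0 ?_, ?_, fun i hi => ?_⟩
  · ext i
    exact congrFun h0 i
  · have := congrArg (fun w : hiddenSpace G D => (w : EuclideanSpace ℝ 𝒱).ofLp) hv
    simpa using this
  · simpa using v.2 0 i hi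

variable {G} {α : ℝ} {ζ : 𝒱 → ℝ}

lemma transpose_driftMatrix_mulVec_mode (hζ : (Gam G).mulVec ζ = α • ζ) (hD : ∀ i ∈ D, ζ i = 0)
    (x y : ℝ) : (driftMatrix G D).transpose.mulVec (Sum.elim (x • ζ) (y • ζ))
      = Sum.elim ((-(y * α)) • ζ) (x • ζ) := by
  ext a
  rcases a with i | i
  · rw [transpose_driftMatrix_mulVec_inl]
    change -(Gam G).mulVec (y • ζ) i = _
    rw [Matrix.mulVec_smul, hζ]
    simp [mul_assoc]
  · rw [transpose_driftMatrix_mulVec_inr]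
    split_ifs with hi
    · simp [hD i hi]
    · simp

lemma dotProduct_mode_controlSpace (hζ : (Gam G).mulVec ζ = α • ζ) (hD : ∀ i ∈ D, ζ i = 0)
    (x y : ℝ) : ∀ v ∈ controlSpace (driftMatrix G D) D, Sum.elim (x • ζ) (y • ζ) ⬝ᵥ v = 0 := by
  apply forall_dotProduct_controlSpace_eq_zero
  intro k
  induction k generalizing x y with
  | zero =>
    intro i hi
    simp [hD i hi]
  | succ k ih =>
    intro i hi
    rw [pow_succ_mulVec, transpose_driftMatrix_mulVec_mode hζ hD]
    exact ih _ _ i hi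

lemma orthogonal_controlSpace (hζ : (Gam G).mulVec ζ = α • ζ) (hD : ∀ i ∈ D, ζ i = 0) :
    ∀ v ∈ controlSpace (driftMatrix G D) D,
      ∑ i, ζ i * v (Sum.inl i) = 0 ∧ ∑ i, ζ i * v (Sum.inr i) = 0 := by
  intro v hv
  have h1 := dotProduct_mode_controlSpace hζ hD 1 0 v hv
  have h2 := dotProduct_mode_controlSpace hζ hD 0 1 v hv
  simp only [dotProduct, Fintype.sum_sum_type] at h1 h2
  exact ⟨by simpa using h1, by simpa using h2⟩

lemma eigenvalue_Gam_pos (hζ0 : ζ ≠ 0) (hζ : (Gam G).mulVec ζ = α • ζ) : 0 < α := by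
  have h1 := (posDef_Gam G).dotProduct_mulVec_pos hζ0
  rw [hζ, star_trivial, dotProduct_smul, smul_eq_mul] at h1
  have h2 : 0 ≤ ζ ⬝ᵥ ζ := Finset.sum_nonneg fun i _ => mul_self_nonneg _
  exact pos_of_mul_pos_left h1 h2

lemma hamiltonianField_harmonic (z : Phase 𝒱) :
    hamiltonianField G harmonic harmonic z = (driftMatrix G ∅).mulVec z := by
  rw [← drift_harmonic, drift]
  ext a
  rcases a with a | a <;> simp

lemma isHamiltonianInvariant_quadraticQuantity (hζ : (Gam G).mulVec ζ = α • ζ) :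
    IsHamiltonianInvariant G harmonic harmonic (quadraticQuantity α ζ) := by
  intro x hx t
  simp only [hamiltonianField_harmonic] at hx
  have hq : ∀ t, HasDerivAt (fun s => ζ ⬝ᵥ fun i => x s (Sum.inl i))
      (ζ ⬝ᵥ fun i => x t (Sum.inr i)) t := by
    intro t
    have h1 : HasDerivAt (fun s i => x s (Sum.inl i)) (fun i => x t (Sum.inr i)) t := by
      rw [hasDerivAt_pi]
      intro i
      have := hasDerivAt_pi.1 (hx t) (Sum.inl i)
      rw [driftMatrix, Matrix.fromBlocks_mulVec] at this
      simpa using this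
    simpa using hasDerivAt_dotProduct (hasDerivAt_const t ζ) h1
  have hp : ∀ t, HasDerivAt (fun s => ζ ⬝ᵥ fun i => x s (Sum.inr i))
      (-α * (ζ ⬝ᵥ fun i => x t (Sum.inl i))) t := by
    intro t
    have h1 : HasDerivAt (fun s i => x s (Sum.inr i))
        (-(Gam G).mulVec fun i => x t (Sum.inl i)) t := by
      rw [hasDerivAt_pi]
      intro i
      have := hasDerivAt_pi.1 (hx t) (Sum.inr i)
      rw [driftMatrix, Matrix.fromBlocks_mulVec] at this
      simpa [Matrix.neg_mulVec, Function.comp_def] using this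
    have h2 := hasDerivAt_dotProduct (hasDerivAt_const t ζ) h1
    rw [zero_dotProduct, zero_add, dotProduct_neg, ← dotProduct_Gam_mulVec, hζ, smul_dotProduct,
      smul_eq_mul, ← neg_mul] at h2
    exact h2
  have hK : ∀ t, HasDerivAt (fun s => quadraticQuantity α ζ (x s)) 0 t := by
    intro t
    refine ((((hq t).fun_pow 2).const_mul α).add ((hp t).fun_pow 2)).congr_deriv ?_
    push_cast
    ring
  exact is_const_of_deriv_eq_zero (fun s => (hK s).differentiableAt) (fun s => (hK s).deriv) t 0

lemma quadraticQuantity_eq_of_eqOn_compl (hD : ∀ i ∈ D, ζ i = 0) (x y : Phase 𝒱)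
    (hxy : ∀ i, i ∉ D → x (Sum.inl i) = y (Sum.inl i) ∧ x (Sum.inr i) = y (Sum.inr i)) :
    quadraticQuantity α ζ x = quadraticQuantity α ζ y := by
  have h : ∀ i, ζ i * x (Sum.inl i) = ζ i * y (Sum.inl i)
      ∧ ζ i * x (Sum.inr i) = ζ i * y (Sum.inr i) := by
    intro i
    by_cases hi : i ∈ D
    · simp [hD i hi]
    · simp [hxy i hi]
  simp [quadraticQuantity, h]

/-- The quadratic form of an undamped mode is invariant under the dual flow. -/
lemma modeForm_dualFlow (hζ : (Gam G).mulVec ζ = α • ζ) (hD : ∀ i ∈ D, ζ i = 0) (ξ : Phase 𝒱)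
    (t : ℝ) :
    (ζ ⬝ᵥ fun i => dualFlow G D t ξ (Sum.inl i)) ^ 2
        + α * (ζ ⬝ᵥ fun i => dualFlow G D t ξ (Sum.inr i)) ^ 2
      = (ζ ⬝ᵥ fun i => ξ (Sum.inl i)) ^ 2 + α * (ζ ⬝ᵥ fun i => ξ (Sum.inr i)) ^ 2 := by
  have ha : ∀ t, HasDerivAt (fun s => ζ ⬝ᵥ fun i => dualFlow G D s ξ (Sum.inl i))
      (-α * (ζ ⬝ᵥ fun i => dualFlow G D t ξ (Sum.inr i))) t := by
    intro t
    have h2 := hasDerivAt_dotProduct (hasDerivAt_const t ζ) (hasDerivAt_dualFlow_inl G D ξ t)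
    rw [zero_dotProduct, zero_add, dotProduct_neg, ← dotProduct_Gam_mulVec, hζ, smul_dotProduct,
      smul_eq_mul, ← neg_mul] at h2
    exact h2
  have hb : ∀ t, HasDerivAt (fun s => ζ ⬝ᵥ fun i => dualFlow G D s ξ (Sum.inr i))
      (ζ ⬝ᵥ fun i => dualFlow G D t ξ (Sum.inl i)) t := by
    intro t
    refine (hasDerivAt_dotProduct (hasDerivAt_const t ζ)
      (hasDerivAt_dualFlow_inr G D ξ t)).congr_deriv ?_
    rw [zero_dotProduct, zero_add]
    refine Finset.sum_congr rfl fun i _ => ?_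
    dsimp only
    split_ifs with hi
    · simp [hD i hi]
    · simp
  have hR : ∀ t, HasDerivAt (fun s => (ζ ⬝ᵥ fun i => dualFlow G D s ξ (Sum.inl i)) ^ 2
      + α * (ζ ⬝ᵥ fun i => dualFlow G D s ξ (Sum.inr i)) ^ 2) 0 t := by
    intro t
    refine (((ha t).fun_pow 2).add (((hb t).fun_pow 2).const_mul α)).congr_deriv ?_
    push_cast
    ring
  simpa using is_const_of_deriv_eq_zero (fun s => (hR s).differentiableAt)
    (fun s => (hR s).deriv) t 0

end Controllability

section Stability

variable {𝒱 : Type*} [Fintype 𝒱] [DecidableEq 𝒱] (G : SimpleGraph 𝒱) [DecidableRel G.Adj]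
  {D : Finset 𝒱}

/-- The energy of a nonzero solution of the dual dynamics decreases strictly. -/
lemma dualEnergy_dualFlow_lt (h : IsAsymmetric G D) {ξ : Phase 𝒱} (hξ : ξ ≠ 0) :
    dualEnergy G (dualFlow G D 1 ξ) < dualEnergy G ξ := by
  rw [dualEnergy_dualFlow]
  suffices 0 < ∫ s in (0 : ℝ)..1, ∑ i ∈ D, dualFlow G D s ξ (Sum.inr i) ^ 2 by linarith
  refine intervalIntegral.integral_pos zero_lt_one (by fun_prop)
    (fun s _ => Finset.sum_nonneg fun i _ => sq_nonneg _) ?_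
  by_contra! hle
  set A := (driftMatrix G D).transpose with hA
  have hzero : ∀ k : ℕ, ∀ i ∈ D, ∀ s ∈ Set.Ioo (0 : ℝ) 1,
      (A ^ k).mulVec (dualFlow G D s ξ) (Sum.inr i) = 0 := by
    intro k
    induction k with
    | zero =>
      intro i hi s hs
      have h1 := hle s (Set.Ioo_subset_Icc_self hs)
      have h2 := Finset.single_le_sum (f := fun j => dualFlow G D s ξ (Sum.inr j) ^ 2)
        (fun j _ => sq_nonneg _) hi
      have h3 : dualFlow G D s ξ (Sum.inr i) ^ 2 = 0 := le_antisymm (h2.trans h1) (sq_nonneg _)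
      simpa using pow_eq_zero_iff two_ne_zero |>.1 h3
    | succ k ih =>
      intro i hi s hs
      have h1 : HasDerivAt (fun r => (A ^ k).mulVec (dualFlow G D r ξ) (Sum.inr i))
          ((A ^ k).mulVec (A.mulVec (dualFlow G D s ξ)) (Sum.inr i)) s := by
        have := ((Matrix.toLin' (A ^ k)).toContinuousLinearMap.hasFDerivAt
          (x := dualFlow G D s ξ)).comp_hasDerivAt s (hasDerivAt_dualFlow G D ξ s)
        have := hasDerivAt_pi.1 this (Sum.inr i)
        simp only [LinearMap.coe_toContinuousLinearMap', Matrix.toLin'_apply,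
          Function.comp_def, ← hA] at this
        exact this
      have h2 : HasDerivAt (fun r => (A ^ k).mulVec (dualFlow G D r ξ) (Sum.inr i)) 0 s := by
        refine (hasDerivAt_const s (0 : ℝ)).congr_of_eventuallyEq ?_
        filter_upwards [Ioo_mem_nhds hs.1 hs.2] with r hr using ih i hi r hr
      rw [pow_succ_mulVec]
      exact h1.unique h2
  have hη : dualFlow G D (1 / 2) ξ = 0 := by
    have h1 := forall_dotProduct_controlSpace_eq_zero (M := driftMatrix G D)
      (fun k i hi => hzero k i hi (1 / 2) (by norm_num)) (dualFlow G D (1 / 2) ξ)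
      (by rw [(isAsymmetric_iff G).1 h]; trivial)
    exact dotProduct_self_eq_zero.1 h1
  apply hξ
  have h2 := dualFlow_add G D (-(1 / 2)) (1 / 2) ξ
  rw [hη, map_zero, neg_add_cancel, dualFlow_zero] at h2
  exact h2

lemma tendsto_dualFlow_nat (h : IsAsymmetric G D) (ξ : Phase 𝒱) :
    Filter.Tendsto (fun n : ℕ => dualFlow G D n ξ) Filter.atTop (nhds 0) := by
  rcases eq_or_ne ξ 0 with rfl | hξ
  · simp
  have hnorm : ∀ η : Phase 𝒱, η ≠ 0 → ‖η‖⁻¹ • η ∈ Metric.sphere (0 : Phase 𝒱) 1 := by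
    intro η hη
    rw [mem_sphere_zero_iff_norm, norm_smul, norm_inv, norm_norm,
      inv_mul_cancel₀ (norm_ne_zero_iff.2 hη)]
  have hne : (Metric.sphere (0 : Phase 𝒱) 1).Nonempty := ⟨_, hnorm ξ hξ⟩
  have hne0 : ∀ η ∈ Metric.sphere (0 : Phase 𝒱) 1, η ≠ 0 := fun η hη h0 => by simp [h0] at hη
  have hcomp : IsCompact (Metric.sphere (0 : Phase 𝒱) 1) := isCompact_sphere _ _
  have hscale : ∀ η : Phase 𝒱, η ≠ 0 → η = ‖η‖ • (‖η‖⁻¹ • η) := fun η hη => by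
    rw [smul_smul, mul_inv_cancel₀ (norm_ne_zero_iff.2 hη), one_smul]
  obtain ⟨η₁, hη₁, hmax⟩ := hcomp.exists_isMaxOn hne
    (f := fun η => dualEnergy G (dualFlow G D 1 η) / dualEnergy G η)
    (((continuous_dualEnergy G).comp (dualFlow G D 1).continuous).continuousOn.div
      (continuous_dualEnergy G).continuousOn fun η hη => (dualEnergy_pos G (hne0 η hη)).ne')
  obtain ⟨η₂, hη₂, hmin⟩ := hcomp.exists_isMinOn hne (continuous_dualEnergy G).continuousOn
  set ρ := dualEnergy G (dualFlow G D 1 η₁) / dualEnergy G η₁ with hρ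
  have hρ0 : 0 ≤ ρ := div_nonneg (dualEnergy_nonneg G _) (dualEnergy_nonneg G _)
  have hρ1 : ρ < 1 := by
    rw [hρ, div_lt_one (dualEnergy_pos G (hne0 η₁ hη₁))]
    exact dualEnergy_dualFlow_lt G h (hne0 η₁ hη₁)
  have hm := dualEnergy_pos G (hne0 η₂ hη₂)
  have hstep : ∀ η, dualEnergy G (dualFlow G D 1 η) ≤ ρ * dualEnergy G η := by
    intro η
    rcases eq_or_ne η 0 with rfl | hη
    · simp
    have h1 := isMaxOn_iff.1 hmax _ (hnorm η hη)
    rw [div_le_iff₀ (dualEnergy_pos G (hne0 _ (hnorm η hη)))] at h1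
    rw [hscale η hη, map_smul, dualEnergy_smul, dualEnergy_smul]
    calc _ ≤ ‖η‖ ^ 2 * (ρ * dualEnergy G (‖η‖⁻¹ • η)) := by gcongr
      _ = _ := by ring
  have hlow : ∀ η, dualEnergy G η₂ * ‖η‖ ^ 2 ≤ dualEnergy G η := by
    intro η
    rcases eq_or_ne η 0 with rfl | hη
    · simp
    have h1 := isMinOn_iff.1 hmin _ (hnorm η hη)
    conv_rhs => rw [hscale η hη, dualEnergy_smul]
    rw [mul_comm]
    gcongr
  have hpow : ∀ n : ℕ, dualEnergy G (dualFlow G D n ξ) ≤ ρ ^ n * dualEnergy G ξ := by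
    intro n
    induction n with
    | zero => simp
    | succ n ih =>
      rw [Nat.cast_succ, add_comm, dualFlow_add, pow_succ', mul_assoc]
      exact (hstep _).trans (by gcongr)
  have hsq : Filter.Tendsto (fun n : ℕ => ‖dualFlow G D n ξ‖ ^ 2) Filter.atTop (nhds 0) := by
    have hlim : Filter.Tendsto (fun n : ℕ => ρ ^ n * dualEnergy G ξ / dualEnergy G η₂)
        Filter.atTop (nhds 0) := by
      simpa using ((tendsto_pow_atTop_nhds_zero_of_lt_one hρ0 hρ1).mul_const
        (dualEnergy G ξ)).div_const (dualEnergy G η₂)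
    refine squeeze_zero (fun n => sq_nonneg _) (fun n => ?_) hlim
    rw [le_div_iff₀ hm, mul_comm]
    exact (hlow _).trans (hpow n)
  rw [tendsto_zero_iff_norm_tendsto_zero]
  simpa using hsq.sqrt

end Stability

section InvariantMeasures

variable {𝒱 : Type*} [Fintype 𝒱] [DecidableEq 𝒱] {G : SimpleGraph 𝒱} [DecidableRel G.Adj]
  {D bd : Finset 𝒱} {T : 𝒱 → ℝ} {Ω : Type*} [MeasurableSpace Ω] {P : Measure Ω}
  [IsProbabilityMeasure P] {B : bd → ℝ≥0 → Ω → ℝ} {Z : Phase 𝒱 → ℝ≥0 → Ω → Phase 𝒱}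

/-- Adding to the stationary covariance a positive semidefinite form that is invariant under the
dual flow gives the covariance of an invariant Gaussian measure. -/
lemma exists_isInvariant_gaussian (hbdD : bd ⊆ D) (hT : ∀ i ∈ bd, 0 ≤ T i)
    (hB : IsBrownianFamily P B)
    (hZ : ∀ z, IsSolution G P harmonic harmonic D bd T B z (Z z))
    {R : Matrix (𝒱 ⊕ 𝒱) (𝒱 ⊕ 𝒱) ℝ} (hR : R.PosSemidef)
    (hinv : ∀ t ξ, dualFlow G D t ξ ⬝ᵥ R.mulVec (dualFlow G D t ξ) = ξ ⬝ᵥ R.mulVec ξ) :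
    ∃ μ : ProbabilityMeasure (Phase 𝒱), IsInvariant P Z μ ∧
      ∀ ξ, dotCharFun (μ : Measure (Phase 𝒱)) ξ = Complex.exp
        ((-(ξ ⬝ᵥ (stationaryCov G D bd T).mulVec ξ + ξ ⬝ᵥ R.mulVec ξ) / 2 : ℝ)) := by
  obtain ⟨μ, hμ⟩ := exists_dotCharFun_eq ((posSemidef_stationaryCov G hbdD hT).add hR)
  simp only [Matrix.add_mulVec, dotProduct_add] at hμ
  refine ⟨μ, ?_, hμ⟩
  rw [isInvariant_iff hT hB hZ]
  intro t ξ
  rw [hμ, hμ, hinv, stationaryCov_dualFlow G T hbdD t ξ, ← Complex.exp_add, ← Complex.ofReal_add]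
  congr 2
  ring

lemma isInvariant_unique (hT : ∀ i ∈ bd, 0 ≤ T i) (hB : IsBrownianFamily P B)
    (hZ : ∀ z, IsSolution G P harmonic harmonic D bd T B z (Z z)) (h : IsAsymmetric G D)
    {μ ν : ProbabilityMeasure (Phase 𝒱)} (hμ : IsInvariant P Z μ) (hν : IsInvariant P Z ν) :
    μ = ν := by
  rw [isInvariant_iff hT hB hZ] at hμ hν
  suffices (μ : Measure (Phase 𝒱)) = ν from Subtype.ext this
  refine ext_of_dotCharFun fun ξ => ?_
  have hlim : ∀ κ : ProbabilityMeasure (Phase 𝒱), Filter.Tendsto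
      (fun n : ℕ => dotCharFun (κ : Measure (Phase 𝒱)) (dualFlow G D n ξ)) Filter.atTop
      (nhds 1) := fun κ => by
    have := ((continuous_dotCharFun (κ : Measure (Phase 𝒱))).tendsto 0).comp
      (tendsto_dualFlow_nat G h ξ)
    rwa [dotCharFun_zero] at this
  have h1 := (hlim ν).const_mul (dotCharFun (μ : Measure (Phase 𝒱)) ξ)
  have h2 := (hlim μ).const_mul (dotCharFun (ν : Measure (Phase 𝒱)) ξ)
  have h3 : ∀ n : ℕ, dotCharFun (ν : Measure (Phase 𝒱)) ξ
        * dotCharFun (μ : Measure (Phase 𝒱)) (dualFlow G D n ξ)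
      = dotCharFun (μ : Measure (Phase 𝒱)) ξ
        * dotCharFun (ν : Measure (Phase 𝒱)) (dualFlow G D n ξ) := by
    intro n
    have e1 := hμ n ξ
    have e2 := hν n ξ
    rw [NNReal.coe_natCast] at e1 e2
    rw [e1, e2]
    ring
  simp only [h3] at h2
  simpa using tendsto_nhds_unique h1 h2

lemma exists_isInvariant (hbdD : bd ⊆ D) (hT : ∀ i ∈ bd, 0 ≤ T i) (hB : IsBrownianFamily P B)
    (hZ : ∀ z, IsSolution G P harmonic harmonic D bd T B z (Z z)) :
    ∃ μ : ProbabilityMeasure (Phase 𝒱), IsInvariant P Z μ ∧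
      ∀ ξ, dotCharFun (μ : Measure (Phase 𝒱)) ξ = Complex.exp
        ((-(ξ ⬝ᵥ (stationaryCov G D bd T).mulVec ξ) / 2 : ℝ)) := by
  simpa using exists_isInvariant_gaussian hbdD hT hB hZ (R := 0) Matrix.PosSemidef.zero (by simp)

/-- An undamped mode yields a second invariant measure. -/
lemma exists_isInvariant_ne (hbdD : bd ⊆ D) (hT : ∀ i ∈ bd, 0 ≤ T i) (hB : IsBrownianFamily P B)
    (hZ : ∀ z, IsSolution G P harmonic harmonic D bd T B z (Z z)) {α : ℝ} {ζ : 𝒱 → ℝ}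
    (hζ0 : ζ ≠ 0) (hζ : (Gam G).mulVec ζ = α • ζ) (hD : ∀ i ∈ D, ζ i = 0) :
    ∃ μ ν : ProbabilityMeasure (Phase 𝒱), μ ≠ ν ∧ IsInvariant P Z μ ∧ IsInvariant P Z ν := by
  set u : Phase 𝒱 := Sum.elim ζ 0 with hu
  set w : Phase 𝒱 := Sum.elim 0 ζ with hw
  set R := Matrix.vecMulVec u u + α • Matrix.vecMulVec w w with hRdef
  have hR : R.PosSemidef := by
    have h1 := Matrix.posSemidef_vecMulVec_self_star u
    have h2 := Matrix.posSemidef_vecMulVec_self_star w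
    rw [star_trivial] at h1 h2
    exact h1.add (h2.smul (eigenvalue_Gam_pos hζ0 hζ).le)
  have hRform : ∀ ξ : Phase 𝒱, ξ ⬝ᵥ R.mulVec ξ = (ζ ⬝ᵥ fun i => ξ (Sum.inl i)) ^ 2
      + α * (ζ ⬝ᵥ fun i => ξ (Sum.inr i)) ^ 2 := by
    intro ξ
    have h1 : u ⬝ᵥ ξ = ζ ⬝ᵥ fun i => ξ (Sum.inl i) := by simp [hu, dotProduct]
    have h2 : w ⬝ᵥ ξ = ζ ⬝ᵥ fun i => ξ (Sum.inr i) := by simp [hw, dotProduct]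
    rw [← h1, ← h2, hRdef, Matrix.add_mulVec, Matrix.smul_mulVec, Matrix.vecMulVec_mulVec,
      Matrix.vecMulVec_mulVec, dotProduct_add]
    simp only [op_smul_eq_smul, dotProduct_smul, smul_eq_mul]
    rw [dotProduct_comm ξ u, dotProduct_comm ξ w]
    ring
  obtain ⟨μ, hμ, hμc⟩ := exists_isInvariant hbdD hT hB hZ
  obtain ⟨ν, hν, hνc⟩ := exists_isInvariant_gaussian hbdD hT hB hZ hR fun t ξ => by
    rw [hRform, hRform, modeForm_dualFlow hζ hD]
  refine ⟨μ, ν, fun heq => ?_, hμ, hν⟩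
  have h1 := hμc u
  rw [heq, hνc u, ← Complex.ofReal_exp, ← Complex.ofReal_exp, Complex.ofReal_inj,
    Real.exp_eq_exp] at h1
  have h2 : u ⬝ᵥ R.mulVec u = (ζ ⬝ᵥ ζ) ^ 2 := by
    rw [hRform]
    simp [hu, dotProduct]
  have h3 : ζ ⬝ᵥ ζ ≠ 0 := fun h => hζ0 (dotProduct_self_eq_zero.1 h)
  have h4 : 0 < (ζ ⬝ᵥ ζ) ^ 2 := by positivity
  linarith

end InvariantMeasures

end HeatNetwork

theorem theorem1 {𝒱 : Type*} [Fintype 𝒱] [DecidableEq 𝒱]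
    (G : SimpleGraph 𝒱) [DecidableRel G.Adj] (hG : G.Connected)
    (D bd : Finset 𝒱) (hbd : bd.Nonempty) (hbdD : bd ⊆ D)
    (T : 𝒱 → ℝ) (hT : ∀ i ∈ bd, 0 ≤ T i)
    {Ω : Type*} [MeasurableSpace Ω] (P : Measure Ω) [IsProbabilityMeasure P]
    (B : bd → ℝ≥0 → Ω → ℝ) (hB : HeatNetwork.IsBrownianFamily P B)
    (Z : HeatNetwork.Phase 𝒱 → ℝ≥0 → Ω → HeatNetwork.Phase 𝒱)
    (hZ : ∀ z, HeatNetwork.IsSolution G P HeatNetwork.harmonic HeatNetwork.harmonic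
      D bd T B z (Z z)) :
    ((∃! μ : ProbabilityMeasure (HeatNetwork.Phase 𝒱), HeatNetwork.IsInvariant P Z μ)
        ↔ HeatNetwork.IsAsymmetric G D) ∧
    (¬ HeatNetwork.IsAsymmetric G D →
      (∃ (α : ℝ) (ζ : 𝒱 → ℝ), ζ ≠ 0 ∧ (HeatNetwork.Gam G).mulVec ζ = α • ζ ∧
        (∀ v ∈ HeatNetwork.controlSpace (HeatNetwork.driftMatrix G D) D,
          ∑ i, ζ i * v (Sum.inl i) = 0 ∧ ∑ i, ζ i * v (Sum.inr i) = 0) ∧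
        HeatNetwork.IsHamiltonianInvariant G HeatNetwork.harmonic HeatNetwork.harmonic
          (HeatNetwork.quadraticQuantity α ζ) ∧
        (∀ x y : HeatNetwork.Phase 𝒱,
          (∀ i, i ∉ D → x (Sum.inl i) = y (Sum.inl i) ∧ x (Sum.inr i) = y (Sum.inr i)) →
          HeatNetwork.quadraticQuantity α ζ x = HeatNetwork.quadraticQuantity α ζ y)) ∧
      (∃ μ ν : ProbabilityMeasure (HeatNetwork.Phase 𝒱),
        μ ≠ ν ∧ HeatNetwork.IsInvariant P Z μ ∧ HeatNetwork.IsInvariant P Z ν)) := by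
  have hmode : ¬ HeatNetwork.IsAsymmetric G D →
      ∃ μ ν : ProbabilityMeasure (HeatNetwork.Phase 𝒱),
        μ ≠ ν ∧ HeatNetwork.IsInvariant P Z μ ∧ HeatNetwork.IsInvariant P Z ν := fun h => by
    obtain ⟨α, ζ, hζ0, hζ, hD⟩ := HeatNetwork.exists_eigenvector_of_not_isAsymmetric G h
    exact HeatNetwork.exists_isInvariant_ne hbdD hT hB hZ hζ0 hζ hD
  refine ⟨⟨fun hex => ?_, fun h => ?_⟩, fun h => ⟨?_, hmode h⟩⟩
  · by_contra h
    obtain ⟨μ, ν, hne, hμ, hν⟩ := hmode h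
    exact hne (hex.unique hμ hν)
  · obtain ⟨μ, hμ, -⟩ := HeatNetwork.exists_isInvariant hbdD hT hB hZ
    exact ⟨μ, hμ, fun ν hν => HeatNetwork.isInvariant_unique hT hB hZ h hν hμ⟩
  · obtain ⟨α, ζ, hζ0, hζ, hD⟩ := HeatNetwork.exists_eigenvector_of_not_isAsymmetric G h
    exact ⟨α, ζ, hζ0, hζ, HeatNetwork.orthogonal_controlSpace hζ hD,
      HeatNetwork.isHamiltonianInvariant_quadraticQuantity hζ,
      HeatNetwork.quadraticQuantity_eq_of_eqOn_compl hD⟩
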